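/- \textbf{Definitions.} An (augmented) semi-cosimplicial Hilbert space (SCH) is a sequence $(H_k)_{k\ge -1}$ of complex Hilbert spaces with isometries $\delta_i:H_{n-1}\to H_n$ ($n\ge 0$, $0\le i\le n$) satisfying $\delta_j\delta_i=\delta_i\delta_{j-1}$ for $0\le i<j\le n$. Reading $\delta_n:H_{n-1}\to H_n$ as an inclusion, let $H_\infty$ be the Hilbert space completion of $\bigcup_k H_k$, and let the partial shifts $\alpha_n$ be the isometries of $H_\infty$ with $\alpha_n|_{H_k}=\delta_n|_{H_k}$ for $k\ge n-1$. The SCH is \emph{saturated} if $H_{n-1}=H_\infty^{\alpha_n}$ (the fixed space of $\alpha_n$) for all $n\ge 0$; its \emph{saturation} is the SCH with spaces $\hat H_{n-1}=H_\infty^{\alpha_n}$ and cofaces $\alpha_i|_{\hat H_{n-1}}$, $0\le i\le n$. Two SCHs are \emph{unitarily equivalent} if there are unitaries between the spaces of each level intertwining the $\delta_i$; identifications of SCHs below are up to unitary equivalence. Let $\mathbb B_\infty$ be the infinite braid group with Artin generators $\sigma_m$, $m\ge1$. The \emph{canonical SCH} of a unitary representation of $\mathbb B_\infty$ on a Hilbert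 space $K$ has $\hat H_{n-1}=\{x\in K:\sigma_\ell x=x \text{ for all } \ell\ge n+1\}$ and $\delta_i=\operatorname{sot-lim}_{m\to\infty}\sigma_{i+1}\sigma_{i+2}\cdots\sigma_m=\sigma_{i+1}\cdots\sigma_n$ on $\hat H_{n-1}$, $0\le i\le n$. For a unitary representation of the group $\mathbb S_\infty$ of finite permutations of $\mathbb N_0$, the canonical SCH is that of the induced representation of $\mathbb B_\infty$ via $\mathbb B_\infty\to\mathbb S_\infty$, $\sigma_m\mapsto(m-1\;\,m)$. An SCH is \emph{braided} (\emph{symmetric}) if its saturation is the canonical SCH of a unitary representation of $\mathbb B_\infty$ ($\mathbb S_\infty$). A \emph{label} $\chi$ is a finite subset of $\mathbb N_0$. For $\chi=\{0,\dots,k\}$, $k\ge 0$, put $L_\chi=\{x\in H_k: x\perp\alpha_i(H_{k-1})\text{ for all } i\ge 0\}$, and put $L_\emptyset=H_{-1}$. For an arbitrary label $\chi$ with $k+1$ elements put $L_\chi=\alpha_{i_r}\cdots\alpha_{i_1}L_{\{0,\dots,k\}}$, where $i_1<\dots<i_r$ are the elements of $\{0,\dots,\max\chi\}\setminus\chi$.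 \textbf{Theorem.} For an SCH $\mathbf S=(H_k,\delta_i)_{k,i}$ the following are equivalent: \begin{itemize} \item[(a)] $\mathbf S$ is symmetric and saturated; \item[(a$'$)] $\mathbf S$ is the canonical SCH of a unitary representation of $\mathbb S_\infty$; \item[(b)] $\mathbf S$ is braided and saturated; \item[(b$'$)] $\mathbf S$ is the canonical SCH of a unitary representation of $\mathbb B_\infty$; \item[(c)] $\mathbf S$ is normal: $\delta_{j-1}\delta_i^*=\delta_i^*\delta_j$ on $H_k$ for all $k\ge 0$ and $0\le i<j\le k+1$; \item[(d)] $\delta_j\bigl(H_k\ominus\delta_i(H_{k-1})\bigr)\subset H_{k+1}\ominus\delta_i(H_k)$ for all $k\ge 0$ and $0\le i<j\le k+1$; \item[(e)] the labeled subspaces $L_\chi$ are mutually orthogonal: $L_\chi\perp L_{\chi'}$ for all labels $\chi\ne\chi'$. \end{itemize} -/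

import Mathlib

open Filter Topology

universe u

/-- An (augmented) semi-cosimplicial Hilbert space: a sequence `(H_k)_{k ≥ -1}` of complex Hilbert
spaces and isometries `δ_i : H_{n-1} → H_n`, `0 ≤ i ≤ n`, with `δ_j δ_i = δ_i δ_{j-1}` for `i < j`.

The levels are shifted by one: `S.H n` is the space of level `n - 1`, so that
`S.δ n i : S.H n → S.H (n + 1)`, `i ≤ n`, is the coface operator `δ_i : H_{n-1} → H_n`.  In the
cosimplicial identity the larger index of the mathematical text is written as `j + 1`. -/
structure SCH where
  H : ℕ → Type u
  [normed : ∀ n, NormedAddCommGroup (H n)]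
  [innerProd : ∀ n, InnerProductSpace ℂ (H n)]
  [complete : ∀ n, CompleteSpace (H n)]
  δ : ∀ n i : ℕ, i ≤ n → H n →ₗᵢ[ℂ] H (n + 1)
  δ_comp : ∀ (n i j : ℕ) (hij : i ≤ j) (hj : j ≤ n) (x : H n),
    δ (n + 1) (j + 1) (by omega) (δ n i (by omega) x) = δ (n + 1) i (by omega) (δ n j hj x)

attribute [instance] SCH.normed SCH.innerProd SCH.complete

noncomputable section

namespace SCH

/-- Unitary equivalence of semi-cosimplicial Hilbert spaces. -/
def UnitarilyEquivalent (S T : SCH.{u}) : Prop :=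
  ∃ U : ∀ n, S.H n ≃ₗᵢ[ℂ] T.H n,
    ∀ (n i : ℕ) (hi : i ≤ n) (x : S.H n), T.δ n i hi (U n x) = U (n + 1) (S.δ n i hi x)

variable (S : SCH.{u})

/-- The top coface operator `δ_n : H_{n-1} → H_n`, read as the inclusion of the tower. -/
def emb (n : ℕ) : S.H n →ₗᵢ[ℂ] S.H (n + 1) := S.δ n n le_rfl

/-! ### The Hilbert space `H_∞`

`H_∞` is the Hilbert space completion of the union of the tower.  An element of the union is
represented by a sequence `x` with `x n ∈ S.H n` that is eventually constant in the sense that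
`x (n + 1)` is the image of `x n` under the inclusion; the inner product of two such sequences is
the eventual value of `⟪x n, y n⟫`.  Sequences at distance zero are identified by the completion. -/

/-- The eventually constant sequences in the tower. -/
def threads : Submodule ℂ (∀ n, S.H n) where
  carrier := {x | ∀ᶠ n in atTop, x (n + 1) = S.emb n (x n)}
  zero_mem' := by simp
  add_mem' := by
    intro x y hx hy
    simp only [Set.mem_ofPred_eq] at *
    filter_upwards [hx, hy] with n h1 h2
    simp [h1, h2]
  smul_mem' := by
    intro c x hx
    simp only [Set.mem_ofPred_eq] at *
    filter_upwards [hx] with n h1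
    simp [h1]

/-- The (not yet separated) union of the tower. -/
def PreLimit : Type u := S.threads

instance : AddCommGroup S.PreLimit := inferInstanceAs (AddCommGroup S.threads)
instance : Module ℂ S.PreLimit := inferInstanceAs (Module ℂ S.threads)

/-- The underlying sequence of an element of the union of the tower. -/
def seq (n : ℕ) : S.PreLimit →ₗ[ℂ] S.H n := (LinearMap.proj n).comp S.threads.subtype

theorem seq_eventually (x : S.PreLimit) :
    ∀ᶠ n in atTop, S.seq (n + 1) x = S.emb n (S.seq n x) := x.2

theorem exists_inner_eq (x y : S.PreLimit) :
    ∃ c : ℂ, ∀ᶠ n in atTop, (inner ℂ (S.seq n x) (S.seq n y) : ℂ) = c := by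
  obtain ⟨N, hN⟩ := eventually_atTop.1 ((S.seq_eventually x).and (S.seq_eventually y))
  refine ⟨inner ℂ (S.seq N x) (S.seq N y), eventually_atTop.2 ⟨N, fun n hn => ?_⟩⟩
  induction n, hn using Nat.le_induction with
  | base => rfl
  | succ n hn ih =>
    rw [(hN n hn).1, (hN n hn).2, LinearIsometry.inner_map_map, ih]

/-- The inner product on the union of the tower. -/
def preInner (x y : S.PreLimit) : ℂ :=
  limUnder atTop fun n => (inner ℂ (S.seq n x) (S.seq n y) : ℂ)

theorem preInner_eventually (x y : S.PreLimit) :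
    ∀ᶠ n in atTop, S.preInner x y = inner ℂ (S.seq n x) (S.seq n y) := by
  obtain ⟨c, hc⟩ := S.exists_inner_eq x y
  have h : S.preInner x y = c :=
    Tendsto.limUnder_eq (tendsto_const_nhds.congr' (hc.mono fun _ h => h.symm))
  filter_upwards [hc] with n hn
  rw [h, hn]

/-- The positive semidefinite sesquilinear form on the union of the tower. -/
@[reducible] def preCore : PreInnerProductSpace.Core ℂ S.PreLimit where
  inner := S.preInner
  conj_inner_symm x y := by
    obtain ⟨n, h1, h2⟩ := ((S.preInner_eventually x y).and (S.preInner_eventually y x)).exists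
    rw [h1, h2, inner_conj_symm]
  re_inner_nonneg x := by
    obtain ⟨n, h1⟩ := (S.preInner_eventually x x).exists
    rw [h1]
    exact inner_self_nonneg
  add_left x y z := by
    obtain ⟨n, h1, h2, h3⟩ := ((S.preInner_eventually (x + y) z).and
      ((S.preInner_eventually x z).and (S.preInner_eventually y z))).exists
    rw [h1, h2, h3, map_add, inner_add_left]
  smul_left x y r := by
    obtain ⟨n, h1, h2⟩ := ((S.preInner_eventually (r • x) y).and
      (S.preInner_eventually x y)).exists
    rw [h1, h2, map_smul, inner_smul_left]

instance : SeminormedAddCommGroup S.PreLimit :=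
  @InnerProductSpace.Core.toSeminormedAddCommGroup ℂ S.PreLimit _ _ _ S.preCore

instance : InnerProductSpace ℂ S.PreLimit := InnerProductSpace.ofCore S.preCore

theorem inner_eventually (x y : S.PreLimit) :
    ∀ᶠ n in atTop, (inner ℂ x y : ℂ) = inner ℂ (S.seq n x) (S.seq n y) :=
  S.preInner_eventually x y

theorem norm_eventually (x : S.PreLimit) : ∀ᶠ n in atTop, ‖x‖ = ‖S.seq n x‖ := by
  filter_upwards [S.inner_eventually x x] with n hn
  rw [@norm_eq_sqrt_re_inner ℂ, hn, ← @norm_eq_sqrt_re_inner ℂ]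

/-- The Hilbert space `H_∞`, the closure of the union of the tower. -/
abbrev Hinf : Type u := UniformSpace.Completion S.PreLimit

/-- The sequence that is `0` below `n`, equal to `x` at `n`, and constant from there on. -/
def constSeq (n : ℕ) : ∀ m, S.H n →ₗ[ℂ] S.H m
  | 0 => if h : n = 0 then h ▸ LinearMap.id else 0
  | m + 1 => if h : n = m + 1 then h ▸ LinearMap.id
      else (S.emb m).toLinearMap.comp (constSeq n m)

theorem constSeq_self (n : ℕ) (x : S.H n) : S.constSeq n n x = x := by
  cases n <;> simp [constSeq]

theorem constSeq_succ {n m : ℕ} (h : n ≤ m) (x : S.H n) :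
    S.constSeq n (m + 1) x = S.emb m (S.constSeq n m x) := by
  have : n ≠ m + 1 := by omega
  simp [constSeq, this]

theorem norm_constSeq {n m : ℕ} (h : n ≤ m) (x : S.H n) : ‖S.constSeq n m x‖ = ‖x‖ := by
  induction m, h using Nat.le_induction with
  | base => rw [constSeq_self]
  | succ m h ih => rw [S.constSeq_succ h, LinearIsometry.norm_map, ih]

/-- The isometry of `S.H n` into the union of the tower. -/
def preι (n : ℕ) : S.H n →ₗᵢ[ℂ] S.PreLimit where
  toFun x := ⟨fun m => S.constSeq n m x,
    eventually_atTop.2 ⟨n, fun _ hm => S.constSeq_succ hm x⟩⟩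
  map_add' x y := Subtype.ext (funext fun m => map_add (S.constSeq n m) x y)
  map_smul' c x := Subtype.ext (funext fun m => map_smul (S.constSeq n m) c x)
  norm_map' x := by
    obtain ⟨m, h1, h2⟩ := ((S.norm_eventually _).and (eventually_ge_atTop n)).exists
    refine h1.trans ?_
    exact S.norm_constSeq h2 x

/-- The embedding of `S.H n` (the space of level `n - 1`) into `H_∞`. -/
def ι (n : ℕ) : S.H n →ₗᵢ[ℂ] S.Hinf :=
  (UniformSpace.Completion.toComplₗᵢ (𝕜 := ℂ) (E := S.PreLimit)).comp (S.preι n)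

/-! ### Partial shifts -/

/-- `δ_i` at level `n - 1` if it is defined there (and `0` otherwise). -/
def coface (n i : ℕ) : S.H n →ₗ[ℂ] S.H (n + 1) :=
  if h : i ≤ n then (S.δ n i h).toLinearMap else 0

theorem coface_of_le {n i : ℕ} (h : i ≤ n) (x : S.H n) : S.coface n i x = S.δ n i h x := by
  simp [coface, h]

/-- `δ_i` applied to each term of a sequence (the first terms are set to `0`). -/
def shiftSeq (i : ℕ) : ∀ n, S.PreLimit →ₗ[ℂ] S.H n
  | 0 => 0
  | n + 1 => (S.coface n i).comp (S.seq n)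

theorem shiftSeq_mem (i : ℕ) (x : S.PreLimit) :
    (fun n => S.shiftSeq i n x) ∈ S.threads := by
  change ∀ᶠ n in atTop, S.shiftSeq i (n + 1) x = S.emb n (S.shiftSeq i n x)
  obtain ⟨N, hN⟩ := eventually_atTop.1 (S.seq_eventually x)
  refine eventually_atTop.2 ⟨N + i + 1, fun n hn => ?_⟩
  obtain ⟨m, rfl⟩ : ∃ m, n = m + 1 := ⟨n - 1, by omega⟩
  change S.coface (m + 1) i (S.seq (m + 1) x) = S.emb (m + 1) (S.coface m i (S.seq m x))
  rw [hN m (by omega), S.coface_of_le (by omega : i ≤ m + 1), S.coface_of_le (by omega : i ≤ m)]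
  exact (S.δ_comp m i m (by omega) le_rfl _).symm

/-- The `i`-th partial shift on the union of the tower. -/
def preα (i : ℕ) : S.PreLimit →ₗᵢ[ℂ] S.PreLimit where
  toFun x := ⟨fun n => S.shiftSeq i n x, S.shiftSeq_mem i x⟩
  map_add' x y := Subtype.ext (funext fun m => map_add (S.shiftSeq i m) x y)
  map_smul' c x := Subtype.ext (funext fun m => map_smul (S.shiftSeq i m) c x)
  norm_map' x := by
    obtain ⟨n, ⟨h1, h2⟩, h3⟩ := ((((tendsto_add_atTop_nat 1).eventually
      (S.norm_eventually ⟨fun n => S.shiftSeq i n x, S.shiftSeq_mem i x⟩)).and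
      (S.norm_eventually x)).and (eventually_ge_atTop i)).exists
    refine h1.trans (Eq.trans ?_ h2.symm)
    change ‖S.coface n i (S.seq n x)‖ = _
    rw [S.coface_of_le h3, LinearIsometry.norm_map]

/-- The `i`-th partial shift `α_i` on `H_∞` associated to the SCH. -/
def α (i : ℕ) : S.Hinf →ₗᵢ[ℂ] S.Hinf where
  toLinearMap := (ContinuousLinearMap.completion (S.preα i).toContinuousLinearMap).toLinearMap
  norm_map' x := by
    induction x using UniformSpace.Completion.induction_on with
    | hp =>
      exact isClosed_eq (continuous_norm.comp (ContinuousLinearMap.continuous _)) continuous_norm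
    | ih a =>
      change ‖UniformSpace.Completion.map (S.preα i) (a : S.Hinf)‖ = _
      rw [UniformSpace.Completion.map_coe (S.preα i).isometry.uniformContinuous]
      simp

theorem α_coe (i : ℕ) (a : S.PreLimit) : S.α i (a : S.Hinf) = ((S.preα i a : S.PreLimit) : S.Hinf) :=
  UniformSpace.Completion.map_coe (S.preα i).isometry.uniformContinuous a

theorem coe_eq_of_eventually {x y : S.PreLimit} (h : ∀ᶠ n in atTop, S.seq n x = S.seq n y) :
    (x : S.Hinf) = (y : S.Hinf) := by
  rw [← sub_eq_zero, ← norm_eq_zero, ← UniformSpace.Completion.coe_sub,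
    UniformSpace.Completion.norm_coe]
  obtain ⟨n, h1, h2⟩ := ((S.norm_eventually (x - y)).and h).exists
  rw [h1, map_sub, h2, sub_self, norm_zero]

/-- In `H_∞` the top coface operators become inclusions. -/
theorem ι_emb (n : ℕ) (x : S.H n) : S.ι (n + 1) (S.emb n x) = S.ι n x := by
  refine S.coe_eq_of_eventually (eventually_atTop.2 ⟨n + 1, fun m hm => ?_⟩)
  change S.constSeq (n + 1) m (S.emb n x) = S.constSeq n m x
  induction m, hm using Nat.le_induction with
  | base => rw [constSeq_self, S.constSeq_succ le_rfl, constSeq_self]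
  | succ m hm ih => rw [S.constSeq_succ hm, ih, S.constSeq_succ (by omega : n ≤ m)]

theorem exists_ι_eq {n k : ℕ} (h : n ≤ k) (z : S.H n) : ∃ w, S.ι k w = S.ι n z := by
  induction k, h using Nat.le_induction with
  | base => exact ⟨z, rfl⟩
  | succ k hk ih =>
    obtain ⟨w, hw⟩ := ih
    exact ⟨S.emb k w, by rw [S.ι_emb, hw]⟩

/-- The partial shift `α_i` restricts to `δ_i` wherever the latter is defined. -/
theorem α_ι (n i : ℕ) (hi : i ≤ n) (x : S.H n) : S.α i (S.ι n x) = S.ι (n + 1) (S.δ n i hi x) := by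
  refine (S.α_coe i _).trans (S.coe_eq_of_eventually (eventually_atTop.2 ⟨n + 1, fun m hm => ?_⟩))
  obtain ⟨m, rfl⟩ : ∃ k, m = k + 1 := ⟨m - 1, by omega⟩
  change S.coface m i (S.constSeq n m x) = S.constSeq (n + 1) (m + 1) (S.δ n i hi x)
  have hm' : n ≤ m := by omega
  clear hm
  induction m, hm' using Nat.le_induction with
  | base => rw [constSeq_self, constSeq_self, S.coface_of_le hi]
  | succ m hm ih =>
    rw [S.constSeq_succ hm, S.constSeq_succ (by omega : n + 1 ≤ m + 1), ← ih,
      S.coface_of_le (by omega : i ≤ m + 1), S.coface_of_le (by omega : i ≤ m)]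
    exact (S.δ_comp m i m (by omega) le_rfl _).symm

/-- The union of the tower is dense in `H_∞`. -/
theorem dense_iUnion_range_ι : Dense (⋃ n, Set.range (S.ι n)) := by
  refine UniformSpace.Completion.denseRange_coe.mono ?_
  rintro _ ⟨x, rfl⟩
  obtain ⟨N, hN⟩ := eventually_atTop.1 (S.seq_eventually x)
  refine Set.mem_iUnion.2 ⟨N, S.seq N x, ?_⟩
  refine S.coe_eq_of_eventually (eventually_atTop.2 ⟨N, fun m hm => ?_⟩)
  change S.constSeq N m (S.seq N x) = S.seq m x
  induction m, hm using Nat.le_induction with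
  | base => rw [constSeq_self]
  | succ m hm ih => rw [S.constSeq_succ hm, ih, hN m hm]

/-- The defining relation of partial shifts, `α_j α_i = α_i α_{j-1}` for `i < j`. -/
theorem α_comp (i j : ℕ) (hij : i ≤ j) (x : S.Hinf) :
    S.α (j + 1) (S.α i x) = S.α i (S.α j x) := by
  have h : (fun x => S.α (j + 1) (S.α i x)) = fun x => S.α i (S.α j x) := by
    refine Continuous.ext_on S.dense_iUnion_range_ι
      ((S.α _).continuous.comp (S.α _).continuous)
      ((S.α _).continuous.comp (S.α _).continuous) ?_
    intro y hy
    obtain ⟨n, z, rfl⟩ := Set.mem_iUnion.1 hy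
    obtain ⟨w, hw⟩ := S.exists_ι_eq (le_max_left n j) z
    have hm : j ≤ max n j := le_max_right n j
    generalize max n j = m at *
    simp only [← hw]
    rw [S.α_ι m i (by omega), S.α_ι m j hm, S.α_ι (m + 1) (j + 1) (by omega),
      S.α_ι (m + 1) i (by omega), S.δ_comp m i j hij hm]
  exact congrFun h x

/-! ### Saturation -/

/-- The fixed point space `H_∞^{α_n}`. -/
def fixed (n : ℕ) : Submodule ℂ S.Hinf :=
  LinearMap.eqLocus (S.α n).toLinearMap LinearMap.id

theorem mem_fixed {n : ℕ} {x : S.Hinf} : x ∈ S.fixed n ↔ S.α n x = x := Iff.rfl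

theorem isClosed_fixed (n : ℕ) : IsClosed (S.fixed n : Set S.Hinf) :=
  isClosed_eq (S.α n).continuous continuous_id

/-- The SCH is saturated if `H_{n-1} = H_∞^{α_n}` for all `n ≥ 0`. -/
def Saturated : Prop :=
  ∀ n, LinearMap.range (S.ι n).toLinearMap = S.fixed n

theorem α_mem_fixed {n i : ℕ} (hi : i ≤ n) {x : S.Hinf} (hx : x ∈ S.fixed n) :
    S.α i x ∈ S.fixed (n + 1) := by
  rw [mem_fixed] at *
  rw [S.α_comp i n hi, hx]

instance instCompleteSpaceFixed (n : ℕ) : CompleteSpace (S.fixed n) :=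
  (S.isClosed_fixed n).completeSpace_coe

/-- The saturation of an SCH: its space of level `n - 1` is `H_∞^{α_n}`, and its coface operators
are restrictions of the partial shifts. -/
def saturation : SCH.{u} where
  H n := S.fixed n
  δ _ i hi :=
    { toFun := fun x => ⟨S.α i x, S.α_mem_fixed hi x.2⟩
      map_add' := fun x y => Subtype.ext (map_add (S.α i) (x : S.Hinf) y)
      map_smul' := fun c x => Subtype.ext (map_smul (S.α i) c (x : S.Hinf))
      norm_map' := fun x => (S.α i).norm_map x }
  δ_comp _ i j hij _ x := Subtype.ext (S.α_comp i j hij x)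

end SCH

/-! ### The infinite braid group and the infinite symmetric group -/

/-- The relations of the infinite braid group; the free generator `m` stands for the Artin generator
`σ_{m+1}`. -/
inductive BraidRel : FreeGroup ℕ → Prop
  | braid (m : ℕ) : BraidRel
      (FreeGroup.of m * FreeGroup.of (m + 1) * FreeGroup.of m *
        (FreeGroup.of (m + 1) * FreeGroup.of m * FreeGroup.of (m + 1))⁻¹)
  | comm (m n : ℕ) (h : m + 2 ≤ n) : BraidRel
      (FreeGroup.of m * FreeGroup.of n * (FreeGroup.of n * FreeGroup.of m)⁻¹)

/-- The infinite braid group `B_∞`. -/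
abbrev BraidInf : Type := PresentedGroup {w : FreeGroup ℕ | BraidRel w}

/-- `artin m` is the Artin generator `σ_{m+1}` of `B_∞`. -/
def artin (m : ℕ) : BraidInf := PresentedGroup.of m

theorem artin_braid (m : ℕ) :
    artin m * artin (m + 1) * artin m = artin (m + 1) * artin m * artin (m + 1) := by
  have := PresentedGroup.one_of_mem (rels := {w : FreeGroup ℕ | BraidRel w}) (BraidRel.braid m)
  rw [map_mul, map_inv, mul_inv_eq_one] at this
  simp only [map_mul] at this
  exact this

theorem artin_comm (m n : ℕ) (h : m + 2 ≤ n) : artin m * artin n = artin n * artin m := by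
  have := PresentedGroup.one_of_mem (rels := {w : FreeGroup ℕ | BraidRel w}) (BraidRel.comm m n h)
  rw [map_mul, map_inv, mul_inv_eq_one] at this
  simp only [map_mul] at this
  exact this

/-- The infinite symmetric group `S_∞` of all finite permutations of `ℕ`. -/
def SymInf : Subgroup (Equiv.Perm ℕ) where
  carrier := {π | {x | π x ≠ x}.Finite}
  one_mem' := by simp
  mul_mem' := by
    intro a b ha hb
    refine (Set.Finite.union ha hb).subset fun x hx => ?_
    by_contra h
    simp only [Set.mem_union, Set.mem_ofPred_eq, not_or, not_not] at h
    exact hx (by rw [Equiv.Perm.mul_apply, h.2, h.1])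
  inv_mem' := by
    intro a ha
    refine Set.Finite.subset ha fun x hx h => hx ?_
    rw [Equiv.Perm.inv_eq_iff_eq, h]

/-- The transposition of `m` and `m + 1`, the image of `σ_{m+1}` in `S_∞`. -/
def transp (m : ℕ) : SymInf :=
  ⟨Equiv.swap m (m + 1), by
    refine (Set.toFinite ({m, m + 1} : Set ℕ)).subset fun x hx => ?_
    by_contra h
    simp only [Set.mem_insert_iff, Set.mem_singleton_iff, not_or] at h
    exact hx (Equiv.swap_apply_of_ne_of_ne h.1 h.2)⟩

/-- The quotient homomorphism `B_∞ → S_∞`. -/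
def braidToSym : BraidInf →* SymInf :=
  PresentedGroup.toGroup (f := transp) (by
    intro w hw
    cases hw with
    | braid m =>
      simp only [map_mul, map_inv, FreeGroup.lift_apply_of, mul_inv_eq_one]
      apply Subtype.ext
      apply Equiv.ext
      intro x
      simp only [transp, Subgroup.coe_mul, Equiv.Perm.mul_apply, Equiv.swap_apply_def]
      split_ifs <;> omega
    | comm m n h =>
      simp only [map_mul, map_inv, FreeGroup.lift_apply_of, mul_inv_eq_one]
      apply Subtype.ext
      apply Equiv.ext
      intro x
      simp only [transp, Subgroup.coe_mul, Equiv.Perm.mul_apply, Equiv.swap_apply_def]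
      split_ifs <;> omega)

/-- `braidProd i d = σ_{i+1} σ_{i+2} ⋯ σ_{i+d}`. -/
def braidProd (i : ℕ) : ℕ → BraidInf
  | 0 => 1
  | d + 1 => braidProd i d * artin (i + d)

theorem artin_mul_braidProd (m i d : ℕ) (h : i + d < m) :
    artin m * braidProd i d = braidProd i d * artin m := by
  induction d with
  | zero => simp [braidProd]
  | succ d ih =>
    rw [braidProd, ← mul_assoc, ih (by omega), mul_assoc, ← artin_comm (i + d) m (by omega),
      mul_assoc]

theorem artin_succ_mul_braidProd (m i d : ℕ) (h1 : i ≤ m) (h2 : m + 1 < i + d) :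
    artin (m + 1) * braidProd i d = braidProd i d * artin m := by
  induction d with
  | zero => omega
  | succ d ih =>
    by_cases h : m + 1 < i + d
    · rw [braidProd, ← mul_assoc, ih h, mul_assoc, artin_comm m (i + d) (by omega), mul_assoc]
    · obtain ⟨e, rfl⟩ : ∃ e, d = e + 1 := ⟨d - 1, by omega⟩
      have hm : m = i + e := by omega
      subst hm
      rw [braidProd, braidProd, ← mul_assoc, ← mul_assoc, artin_mul_braidProd _ _ _ (by omega),
        ← add_assoc i e 1]
      simp only [mul_assoc]
      congr 1
      simpa only [mul_assoc] using (artin_braid (i + e)).symm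

theorem braidProd_mul_braidProd (i j d : ℕ) (h1 : i ≤ j) (e : ℕ) (h2 : j + e + 1 ≤ i + d) :
    braidProd (j + 1) e * braidProd i d = braidProd i d * braidProd j e := by
  induction e with
  | zero => simp [braidProd]
  | succ e ih =>
    rw [braidProd, braidProd, mul_assoc, show j + 1 + e = (j + e) + 1 by omega,
      artin_succ_mul_braidProd (j + e) i d (by omega) (by omega), ← mul_assoc, ih (by omega),
      mul_assoc]

/-! ### The canonical SCH of a unitary representation -/

section canonical

variable {K : Type u} [NormedAddCommGroup K] [InnerProductSpace ℂ K]
  (ρ : BraidInf →* (K ≃ₗᵢ[ℂ] K))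

/-- The space of vectors fixed by all `σ_ℓ` with `ℓ ≥ n + 1` (the tower at level `n - 1`). -/
def braidFixed (n : ℕ) : Submodule ℂ K :=
  ⨅ m : {m : ℕ // n ≤ m}, LinearMap.eqLocus (ρ (artin m)).toLinearEquiv.toLinearMap LinearMap.id

theorem mem_braidFixed {n : ℕ} {x : K} :
    x ∈ braidFixed ρ n ↔ ∀ m, n ≤ m → ρ (artin m) x = x := by
  simp only [braidFixed, Submodule.mem_iInf, Subtype.forall]
  rfl

theorem isClosed_braidFixed (n : ℕ) : IsClosed (braidFixed ρ n : Set K) := by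
  have : (braidFixed ρ n : Set K) = ⋂ m : {m : ℕ // n ≤ m}, {x | ρ (artin m) x = x} := by
    ext x
    simp [mem_braidFixed]
  rw [this]
  exact isClosed_iInter fun m => isClosed_eq (ρ (artin m)).continuous continuous_id

instance [CompleteSpace K] (n : ℕ) : CompleteSpace (braidFixed ρ n) :=
  (isClosed_braidFixed ρ n).completeSpace_coe

theorem braidProd_mem {n i : ℕ} (hi : i ≤ n) {x : K} (hx : x ∈ braidFixed ρ n) :
    ρ (braidProd i (n - i)) x ∈ braidFixed ρ (n + 1) := by
  rw [mem_braidFixed] at *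
  intro m hm
  change (ρ (artin m) * ρ (braidProd i (n - i))) x = _
  rw [← map_mul, artin_mul_braidProd m i (n - i) (by omega), map_mul]
  exact congrArg _ (hx m (by omega))

/-- The defining limit `α_i = sot-lim σ_{i+1} σ_{i+2} ⋯ σ_m` of the partial shifts of a
representation of `B_∞` agrees, on the tower at level `n - 1`, with `σ_{i+1} ⋯ σ_n`. -/
theorem tendsto_braidProd {n i : ℕ} (hi : i ≤ n) {x : K} (hx : x ∈ braidFixed ρ n) :
    Tendsto (fun d => ρ (braidProd i d) x) atTop (𝓝 (ρ (braidProd i (n - i)) x)) := by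
  refine tendsto_const_nhds.congr' (eventually_atTop.2 ⟨n - i, fun d hd => ?_⟩)
  induction d, hd using Nat.le_induction with
  | base => rfl
  | succ d hd ih =>
    rw [ih]
    change ρ (braidProd i d) x = ρ (braidProd i d * artin (i + d)) x
    rw [map_mul]
    exact congrArg _ ((mem_braidFixed ρ).1 hx (i + d) (by omega)).symm

/-- The canonical SCH of a unitary representation of `B_∞`: its space of level `n - 1` is the space
of common fixed points of the `σ_ℓ`, `ℓ ≥ n + 1`, and the coface operator `δ_i` is the restriction
`σ_{i+1} ⋯ σ_n` of `α_i = sot-lim σ_{i+1} σ_{i+2} ⋯ σ_m`. -/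
def canonicalSCH [CompleteSpace K] : SCH.{u} where
  H n := braidFixed ρ n
  δ n i hi :=
    { toFun := fun x => ⟨ρ (braidProd i (n - i)) x, braidProd_mem ρ hi x.2⟩
      map_add' := fun x y => Subtype.ext (map_add (ρ (braidProd i (n - i))) (x : K) y)
      map_smul' := fun c x => Subtype.ext (map_smul (ρ (braidProd i (n - i))) c (x : K))
      norm_map' := fun x => (ρ (braidProd i (n - i))).norm_map x }
  δ_comp n i j hij hj x := by
    apply Subtype.ext
    change (ρ (braidProd (j + 1) (n + 1 - (j + 1))) * ρ (braidProd i (n - i))) (x : K) =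
      (ρ (braidProd i (n + 1 - i)) * ρ (braidProd j (n - j))) (x : K)
    have hx : ρ (braidProd i (n - i)) (x : K) = ρ (braidProd i (n + 1 - i)) (x : K) := by
      rw [show n + 1 - i = (n - i) + 1 by omega, braidProd, map_mul]
      exact congrArg _ ((mem_braidFixed ρ).1 x.2 (i + (n - i)) (by omega)).symm
    rw [← map_mul, ← map_mul, ← braidProd_mul_braidProd i j (n + 1 - i) hij (n - j) (by omega),
      show n + 1 - (j + 1) = n - j by omega, map_mul, map_mul]
    exact congrArg (ρ (braidProd (j + 1) (n - j))) hx

end canonical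

namespace SCH

/-- `S` is, up to unitary equivalence, the canonical SCH of a unitary representation of `B_∞`. -/
def IsCanonicalBraid (S : SCH.{u}) : Prop :=
  ∃ (K : Type u) (_ : NormedAddCommGroup K) (_ : InnerProductSpace ℂ K) (_ : CompleteSpace K)
    (ρ : BraidInf →* (K ≃ₗᵢ[ℂ] K)), S.UnitarilyEquivalent (canonicalSCH ρ)

/-- `S` is, up to unitary equivalence, the canonical SCH of a unitary representation of `S_∞`. -/
def IsCanonicalSym (S : SCH.{u}) : Prop :=
  ∃ (K : Type u) (_ : NormedAddCommGroup K) (_ : InnerProductSpace ℂ K) (_ : CompleteSpace K)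
    (ρ : SymInf →* (K ≃ₗᵢ[ℂ] K)), S.UnitarilyEquivalent (canonicalSCH (ρ.comp braidToSym))

variable (S : SCH.{u})

/-- An SCH is braided if its saturation is the canonical SCH of a unitary representation of
`B_∞`. -/
def Braided : Prop := S.saturation.IsCanonicalBraid

/-- An SCH is symmetric if its saturation is the canonical SCH of a unitary representation of
`S_∞`. -/
def Symmetric : Prop := S.saturation.IsCanonicalSym

/-- An SCH is normal if `δ_{j-1} δ_i^* = δ_i^* δ_j` for `i < j` (with `j + 1` in place of `j`);
both sides are maps on `S.H (n + 1)`, the space of level `n`. -/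
def Normal : Prop :=
  ∀ (n i j : ℕ) (hij : i ≤ j) (hj : j ≤ n),
    (S.δ n j hj).toContinuousLinearMap.comp
        (ContinuousLinearMap.adjoint (S.δ n i (hij.trans hj)).toContinuousLinearMap) =
      (ContinuousLinearMap.adjoint (S.δ (n + 1) i (by omega)).toContinuousLinearMap).comp
        (S.δ (n + 1) (j + 1) (by omega)).toContinuousLinearMap

/-- `δ_j (H_k ⊖ δ_i H_{k-1}) ⊆ H_{k+1} ⊖ δ_i H_k` for `i < j` (with `j + 1` in place of `j`, and
with `S.H (n + 1)` as the space of level `k = n`). -/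
def PreservesComplements : Prop :=
  ∀ (n i j : ℕ) (hij : i ≤ j) (hj : j ≤ n),
    Submodule.map (S.δ (n + 1) (j + 1) (by omega)).toLinearMap
        (LinearMap.range (S.δ n i (hij.trans hj)).toLinearMap)ᗮ ≤
      (LinearMap.range (S.δ (n + 1) i (by omega)).toLinearMap)ᗮ

/-! ### Labeled subspaces

A label is a finite subset of `ℕ` (a finite binary sequence, given by the positions of its ones);
its rank is its cardinality and its level is its maximum (`-1` if it is empty). -/

/-- The labeled subspace of the root of rank `r`, i.e. of the label `{0, …, r - 1}` of level
`r - 1`: all `x ∈ H_{r-1}` that are orthogonal to `α_i (H_{r-2})` for every `i`; for `r = 0` this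
is the whole of `H_{-1}`. -/
def rootSpace : ℕ → Submodule ℂ S.Hinf
  | 0 => LinearMap.range (S.ι 0).toLinearMap
  | r + 1 => LinearMap.range (S.ι (r + 1)).toLinearMap ⊓
      ⨅ i : ℕ, (Submodule.map (S.α i).toLinearMap (LinearMap.range (S.ι r).toLinearMap))ᗮ

/-- The isometry `α_f = α_{i_k} ⋯ α_{i_1}` of the label `χ`, where `i_1 < ⋯ < i_k` are the numbers
below the maximum of `χ` that do not belong to `χ`. -/
def labelShift (χ : Finset ℕ) : S.Hinf →ₗᵢ[ℂ] S.Hinf :=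
  ((((Finset.range (χ.sup id)) \ χ).sort (· ≥ ·)).map S.α).prod

/-- The labeled subspace `L_χ`. -/
def labeled (χ : Finset ℕ) : Submodule ℂ S.Hinf :=
  Submodule.map (S.labelShift χ).toLinearMap (S.rootSpace χ.card)

/-- The labeled subspaces are orthogonal to each other. -/
def LabeledOrthogonal : Prop :=
  ∀ χ χ' : Finset ℕ, χ ≠ χ' → S.labeled χ ⟂ S.labeled χ'

end SCH

end

/-! Write E_n for the image `level n` of the space of level n - 1 in H_∞, P_n for the projection
onto it and K_n for `braidFixed ρ n`. Conditions (c) and (d) say the same thing: split x along the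
range of δ_i; on the range both sides of (c) agree by the cosimplicial identity, so (c) asserts
exactly that the complement is respected. The substance lies in three places.

Braid representations give (d). Conjugation by braid words reduces (d) to one claim,
`inner_artin_eq_zero`: if x ∈ K_{n+1} ⊖ K_n and z ∈ K_{n+1}, then σ_{n+1} z ⟂ x. Since x is fixed by
all later generators, σ_{n+1} z may be replaced by σ_{n+d} ⋯ σ_{n+1} z without changing the inner
product. By the braid relations this vector is fixed by σ_{n+1}, …, σ_{n+d-1}. The fixed spaces of
these finite sets decrease to K_n, so x is a limit of vectors orthogonal to them, and the inner
product is 0.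

Labels. In every SCH the subspaces L_χ are total, because a vector of E_{n+1} orthogonal to all
shifted labeled vectors already lies in the root space (`level_le_closure_labeledSpan`), and α_i
sends L_χ to L_{χ'}, where χ' is χ with a gap inserted at i (`map_α_labeled`). If the L_χ are
orthogonal, then E_{n+1} ⊖ α_i E_n (i ≤ n) is the closed span of the L_χ with i ∈ χ, and for i < j
the shift α_j keeps i in the label; this is (d). Conversely, normality passes to H_∞ as α_j α_i^* =
α_i^* α_{j+1} for i ≤ j. Then α_i^* kills L_χ when i ∈ χ, whereas L_χ lies in the range of α_i when
i ∉ χ; two distinct labels are separated by such an i.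

Normality gives a representation of S_∞. By (e), H_∞ is the Hilbert sum of the L_χ, all labels of
one rank carry copies of one root space, and permutations of ℕ act by permuting labels. Below i + d
the permutation of σ_{i+1} ⋯ σ_{i+d} inserts a gap at i, so this product acts as α_i on E_{i+d}.
Normality also yields P_{n+1} α_i = α_i P_n for i ≤ n, hence saturation, and saturation identifies
the fixed spaces of the representation with the E_n. -/

noncomputable section

namespace SCH

variable (S : SCH.{u})

/-! ### The tower inside `H_∞` -/

/-- The space of level `n - 1` as a closed subspace of `H_∞`. -/
def level (n : ℕ) : Submodule ℂ S.Hinf := LinearMap.range (S.ι n).toLinearMap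

variable {S}

theorem ι_mem_level (n : ℕ) (x : S.H n) : S.ι n x ∈ S.level n := ⟨x, rfl⟩

instance instCompleteSpaceLevel (n : ℕ) : CompleteSpace (S.level n) :=
  ((S.ι n).isometry.isUniformInducing.isComplete_range).completeSpace_coe

theorem isClosed_level (n : ℕ) : IsClosed (S.level n : Set S.Hinf) :=
  ((S.ι n).isometry.isUniformInducing.isComplete_range).isClosed

theorem level_mono : Monotone S.level := by
  rintro n k h _ ⟨z, rfl⟩
  obtain ⟨w, hw⟩ := S.exists_ι_eq h z
  exact ⟨w, hw⟩

theorem α_eq_self {n i : ℕ} (h : n ≤ i) {x : S.Hinf} (hx : x ∈ S.level n) : S.α i x = x := by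
  obtain ⟨w, rfl⟩ := level_mono h hx
  exact (S.α_ι i i le_rfl w).trans (S.ι_emb i w)

theorem α_mem_level {n : ℕ} (i : ℕ) {x : S.Hinf} (hx : x ∈ S.level n) :
    S.α i x ∈ S.level (n + 1) := by
  rcases le_total n i with h | h
  · rw [α_eq_self h hx]
    exact level_mono n.le_succ hx
  · obtain ⟨w, rfl⟩ := hx
    exact ⟨_, (S.α_ι n i h w).symm⟩

theorem dense_iSup_level : (⨆ n, S.level n).topologicalClosure = ⊤ := by
  rw [← Submodule.dense_iff_topologicalClosure_eq_top]
  exact S.dense_iUnion_range_ι.mono (Set.iUnion_subset fun n => le_iSup S.level n)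

/-! ### Shifts of labels -/

/-- The order embedding of `ℕ` that omits `i`. -/
def gapMap (i : ℕ) : ℕ ↪o ℕ :=
  OrderEmbedding.ofStrictMono (fun c => if c < i then c else c + 1) (by
    intro a b h
    dsimp only
    split_ifs <;> omega)

theorem gapMap_apply (i c : ℕ) : gapMap i c = if c < i then c else c + 1 := rfl

/-- The label obtained by inserting a gap at position `i`. -/
def gap (i : ℕ) (χ : Finset ℕ) : Finset ℕ := χ.map (gapMap i).toEmbedding

theorem card_gap (i : ℕ) (χ : Finset ℕ) : (gap i χ).card = χ.card := Finset.card_map _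

theorem mem_gap_of_lt {i m : ℕ} {χ : Finset ℕ} (h : m < i) : m ∈ gap i χ ↔ m ∈ χ := by
  simp only [gap, Finset.mem_map, RelEmbedding.coe_toEmbedding, gapMap_apply]
  constructor
  · rintro ⟨c, hc, rfl⟩
    split_ifs at * with h1
    · exact hc
    · omega
  · exact fun hm => ⟨m, hm, if_pos h⟩

theorem notMem_gap (i : ℕ) (χ : Finset ℕ) : i ∉ gap i χ := by
  simp only [gap, Finset.mem_map, RelEmbedding.coe_toEmbedding, gapMap_apply]
  rintro ⟨c, hc, h⟩
  split_ifs at h <;> omega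

theorem succ_mem_gap {i m : ℕ} {χ : Finset ℕ} (h : i ≤ m) : m + 1 ∈ gap i χ ↔ m ∈ χ := by
  simp only [gap, Finset.mem_map, RelEmbedding.coe_toEmbedding, gapMap_apply]
  constructor
  · rintro ⟨c, hc, h'⟩
    split_ifs at h' with h1
    · omega
    · rwa [← Nat.succ_injective h']
  · exact fun hm => ⟨m, hm, if_neg (by omega)⟩

theorem gap_subset_range {i n : ℕ} {χ : Finset ℕ} (h : χ ⊆ Finset.range n) :
    gap i χ ⊆ Finset.range (n + 1) := by
  intro m hm
  obtain ⟨c, hc, rfl⟩ := Finset.mem_map.1 hm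
  have := Finset.mem_range.1 (h hc)
  simp only [RelEmbedding.coe_toEmbedding, gapMap_apply, Finset.mem_range]
  split_ifs <;> omega

theorem exists_gap_eq {i n : ℕ} {χ : Finset ℕ} (hi : i ≤ n) (h : χ ⊆ Finset.range (n + 1))
    (hχ : i ∉ χ) : ∃ χ' ⊆ Finset.range n, gap i χ' = χ := by
  refine ⟨(Finset.range n).filter (gapMap i · ∈ χ), Finset.filter_subset _ _, ?_⟩
  ext m
  simp only [gap, Finset.mem_map, RelEmbedding.coe_toEmbedding, Finset.mem_filter,
    Finset.mem_range]
  constructor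
  · rintro ⟨c, hc, rfl⟩
    exact hc.2
  · intro hm
    have h1 := Finset.mem_range.1 (h hm)
    rcases lt_trichotomy m i with h2 | rfl | h2
    · have : gapMap i m = m := if_pos h2
      exact ⟨m, ⟨by omega, by rwa [this]⟩, this⟩
    · exact absurd hm hχ
    · have : gapMap i (m - 1) = m := by
        rw [gapMap_apply, if_neg (by omega)]
        omega
      exact ⟨m - 1, ⟨by omega, by rwa [this]⟩, this⟩

/-! ### Products of partial shifts along the gaps of a label -/

variable (S)

/-- The product, in decreasing order, of the partial shifts `α_m`, `m < N`, `m ∉ χ`. -/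
def gapShift (χ : Finset ℕ) : ℕ → (S.Hinf →ₗᵢ[ℂ] S.Hinf)
  | 0 => 1
  | N + 1 => if N ∈ χ then gapShift χ N else S.α N * gapShift χ N

variable {S}

theorem gapShift_succ_of_mem {χ : Finset ℕ} {N : ℕ} (h : N ∈ χ) :
    S.gapShift χ (N + 1) = S.gapShift χ N := if_pos h

theorem gapShift_succ_of_notMem {χ : Finset ℕ} {N : ℕ} (h : N ∉ χ) :
    S.gapShift χ (N + 1) = S.α N * S.gapShift χ N := if_neg h

theorem prod_sort_eq_gapShift (χ : Finset ℕ) (N : ℕ) :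
    ((((Finset.range N) \ χ).sort (· ≥ ·)).map S.α).prod = S.gapShift χ N := by
  induction N with
  | zero => simp [gapShift]
  | succ N ih =>
    by_cases h : N ∈ χ
    · rw [gapShift_succ_of_mem h, ← ih, Finset.range_add_one, Finset.insert_sdiff_of_mem _ h]
    · rw [gapShift_succ_of_notMem h, ← ih, Finset.range_add_one,
        Finset.insert_sdiff_of_notMem _ h, Finset.sort_insert, List.map_cons, List.prod_cons]
      · intro b hb
        exact (Finset.mem_range.1 (Finset.mem_sdiff.1 hb).1).le
      · simp

theorem gapShift_congr {χ χ' : Finset ℕ} {N : ℕ} (h : ∀ m < N, m ∈ χ ↔ m ∈ χ') :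
    S.gapShift χ N = S.gapShift χ' N := by
  induction N with
  | zero => rfl
  | succ N ih =>
    have ih := ih fun m hm => h m (by omega)
    have hN := h N (by omega)
    by_cases hc : N ∈ χ
    · rw [gapShift_succ_of_mem hc, gapShift_succ_of_mem (hN.1 hc), ih]
    · rw [gapShift_succ_of_notMem hc, gapShift_succ_of_notMem (mt hN.2 hc), ih]

/-- The relation α_i α_N = α_{N+1} α_i moves α_i to the right past every factor of index at least i,
raising that index by one, until it reaches its place in the decreasing product. On labels this is
the insertion of a gap at i. -/
theorem α_mul_gapShift {i N : ℕ} (h : i ≤ N) (χ : Finset ℕ) :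
    S.α i * S.gapShift χ N = S.gapShift (gap i χ) (N + 1) := by
  induction N, h using Nat.le_induction with
  | base =>
    rw [gapShift_succ_of_notMem (notMem_gap i χ),
      gapShift_congr (fun m hm => (mem_gap_of_lt hm).symm)]
  | succ N hN ih =>
    by_cases hc : N ∈ χ
    · rw [gapShift_succ_of_mem hc, gapShift_succ_of_mem ((succ_mem_gap hN).2 hc), ih]
    · rw [gapShift_succ_of_notMem hc, gapShift_succ_of_notMem (mt (succ_mem_gap hN).1 hc), ← ih,
        ← mul_assoc, ← mul_assoc]
      congr 1
      ext x
      exact (S.α_comp i N hN x).symm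

/-! ### Root spaces and the levels of labeled vectors -/

theorem rootSpace_le_level (r : ℕ) : S.rootSpace r ≤ S.level r := by
  cases r with
  | zero => exact le_rfl
  | succ r => exact inf_le_left

theorem isClosed_rootSpace (r : ℕ) : IsClosed (S.rootSpace r : Set S.Hinf) := by
  cases r with
  | zero => exact isClosed_level 0
  | succ r =>
    simp only [rootSpace, Submodule.coe_inf, Submodule.coe_iInf]
    exact (isClosed_level (r + 1)).inter
      (isClosed_iInter fun i => Submodule.isClosed_orthogonal _)

instance instCompleteSpaceRootSpace (r : ℕ) : CompleteSpace (S.rootSpace r) :=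
  (isClosed_rootSpace r).completeSpace_coe

theorem card_sdiff_range_of_mem {χ : Finset ℕ} {N : ℕ} (h : N ∈ χ) :
    (χ \ Finset.range N).card = (χ \ Finset.range (N + 1)).card + 1 := by
  rw [← Finset.card_insert_of_notMem (a := N) (by simp)]
  congr 1
  ext m
  simp only [Finset.mem_sdiff, Finset.mem_range, Finset.mem_insert]
  constructor
  · rintro ⟨h1, h2⟩
    by_cases hm : m = N
    · exact Or.inl hm
    · exact Or.inr ⟨h1, by omega⟩
  · rintro (rfl | ⟨h1, h2⟩)
    · exact ⟨h, by omega⟩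
    · exact ⟨h1, by omega⟩

theorem card_sdiff_range_of_notMem {χ : Finset ℕ} {N : ℕ} (h : N ∉ χ) :
    (χ \ Finset.range N).card = (χ \ Finset.range (N + 1)).card := by
  congr 1
  ext m
  simp only [Finset.mem_sdiff, Finset.mem_range]
  refine and_congr_right fun hm => ?_
  have : m ≠ N := fun e => h (e ▸ hm)
  omega

/-- The level is the number N of positions already decided plus the number of elements of χ still to
be placed. A position in χ leaves the sum unchanged; a gap raises it by one, as does the shift
applied there. -/
theorem gapShift_mem_level (χ : Finset ℕ) (N : ℕ) {x : S.Hinf} (hx : x ∈ S.level χ.card) :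
    S.gapShift χ N x ∈ S.level (N + (χ \ Finset.range N).card) := by
  induction N with
  | zero => simpa [gapShift] using hx
  | succ N ih =>
    by_cases hc : N ∈ χ
    · rw [gapShift_succ_of_mem hc]
      rw [card_sdiff_range_of_mem hc] at ih
      exact level_mono (by omega) ih
    · rw [gapShift_succ_of_notMem hc, ← card_sdiff_range_of_notMem hc]
      exact level_mono (by omega) (α_mem_level N ih)

theorem gapShift_mem_level_of_subset {χ : Finset ℕ} {N : ℕ} (h : χ ⊆ Finset.range N) {x : S.Hinf}
    (hx : x ∈ S.level χ.card) : S.gapShift χ N x ∈ S.level N := by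
  have := gapShift_mem_level χ N hx
  rwa [Finset.sdiff_eq_empty_iff_subset.2 h, Finset.card_empty, add_zero] at this

theorem subset_range_sup (χ : Finset ℕ) : χ ⊆ Finset.range (χ.sup id + 1) := fun _ hm =>
  Finset.mem_range.2 (Nat.lt_succ_of_le (Finset.le_sup (f := id) hm))

theorem gapShift_eq_of_subset {χ : Finset ℕ} {N M : ℕ} (h : χ ⊆ Finset.range N) (hM : N ≤ M)
    {x : S.Hinf} (hx : x ∈ S.level χ.card) : S.gapShift χ M x = S.gapShift χ N x := by
  induction M, hM using Nat.le_induction with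
  | base => rfl
  | succ M hM ih =>
    have hc : M ∉ χ := fun hm => by
      have := Finset.mem_range.1 (h hm)
      omega
    rw [gapShift_succ_of_notMem hc, LinearIsometry.coe_mul, Function.comp_apply, ih,
      α_eq_self hM (gapShift_mem_level_of_subset h hx)]

theorem labelShift_eq_gapShift_sup (χ : Finset ℕ) : S.labelShift χ = S.gapShift χ (χ.sup id) :=
  prod_sort_eq_gapShift χ _

/-- Shifts at positions beyond the label act trivially on the level already reached, so any upper
bound N can replace the maximum of χ. This allows two labels to be compared with a common bound. -/
theorem labelShift_eq_gapShift {χ : Finset ℕ} {N : ℕ} (h : χ ⊆ Finset.range N) {x : S.Hinf}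
    (hx : x ∈ S.level χ.card) : S.labelShift χ x = S.gapShift χ N x := by
  have h1 : S.gapShift χ (χ.sup id + 1) x = S.gapShift χ N x := by
    rw [← gapShift_eq_of_subset (subset_range_sup χ) (le_max_left _ N) hx,
      ← gapShift_eq_of_subset h (le_max_right (χ.sup id + 1) N) hx]
  rw [← h1, labelShift_eq_gapShift_sup]
  rcases χ.eq_empty_or_nonempty with rfl | hne
  -- The supremum of the empty label is 0, not -1, so the bound `χ.sup id + 1` brings in a spurious
  -- α_0, which fixes the bottom level.
  · change S.gapShift ∅ 0 x = S.gapShift ∅ (0 + 1) x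
    rw [gapShift_succ_of_notMem (Finset.notMem_empty 0), LinearIsometry.coe_mul,
      Function.comp_apply]
    exact (α_eq_self le_rfl hx).symm
  · rw [gapShift_succ_of_mem]
    obtain ⟨m, hm, he⟩ := Finset.exists_mem_eq_sup χ hne id
    rw [he]
    exact hm

/-- Partial shifts act on labeled vectors by inserting gaps into the labels. -/
theorem α_labelShift (i : ℕ) (χ : Finset ℕ) {x : S.Hinf} (hx : x ∈ S.level χ.card) :
    S.α i (S.labelShift χ x) = S.labelShift (gap i χ) x := by
  have h1 : χ ⊆ Finset.range (max i (χ.sup id + 1)) :=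
    (subset_range_sup χ).trans (Finset.range_mono (le_max_right _ _))
  rw [labelShift_eq_gapShift h1 hx, labelShift_eq_gapShift (gap_subset_range (i := i) h1)
    (by rwa [card_gap]), ← α_mul_gapShift (le_max_left _ _)]
  rfl

theorem labelShift_mem_labeled {χ : Finset ℕ} {x : S.Hinf} (hx : x ∈ S.rootSpace χ.card) :
    S.labelShift χ x ∈ S.labeled χ := ⟨x, hx, rfl⟩

theorem map_α_labeled (i : ℕ) (χ : Finset ℕ) :
    Submodule.map (S.α i).toLinearMap (S.labeled χ) = S.labeled (gap i χ) := by
  ext y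
  constructor
  · rintro ⟨_, ⟨x, hx, rfl⟩, rfl⟩
    exact ⟨x, by rwa [card_gap], (α_labelShift i χ (rootSpace_le_level _ hx)).symm⟩
  · rintro ⟨x, hx, rfl⟩
    rw [card_gap] at hx
    exact ⟨_, labelShift_mem_labeled hx, α_labelShift i χ (rootSpace_le_level _ hx)⟩

theorem labeled_le_level {χ : Finset ℕ} {N : ℕ} (h : χ ⊆ Finset.range N) :
    S.labeled χ ≤ S.level N := by
  rintro _ ⟨x, hx, rfl⟩
  have hx' := rootSpace_le_level _ hx
  change S.labelShift χ x ∈ _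
  rw [labelShift_eq_gapShift h hx']
  exact gapShift_mem_level_of_subset h hx'

theorem gapShift_range (N : ℕ) : S.gapShift (Finset.range N) N = 1 := by
  have : ∀ M ≤ N, S.gapShift (Finset.range N) M = 1 := by
    intro M hM
    induction M with
    | zero => rfl
    | succ M ih => rw [gapShift_succ_of_mem (Finset.mem_range.2 hM), ih (by omega)]
  exact this N le_rfl

theorem labeled_range (N : ℕ) : S.labeled (Finset.range N) = S.rootSpace N := by
  have h : ∀ x ∈ S.rootSpace N, S.labelShift (Finset.range N) x = x := fun x hx => by
    rw [labelShift_eq_gapShift (le_refl (Finset.range N)), gapShift_range]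
    · rfl
    · simpa using rootSpace_le_level _ hx
  ext y
  constructor
  · rintro ⟨x, hx, rfl⟩
    rw [Finset.card_range] at hx
    change S.labelShift _ x ∈ _
    rwa [h x hx]
  · intro hy
    exact ⟨y, by rwa [Finset.card_range], h y hy⟩

/-! ### The labeled subspaces are total -/

variable (S) in
/-- The span of the labeled subspaces with label contained in `{0, …, n - 1}` and satisfying `p`. -/
def labeledSpan (n : ℕ) (p : Finset ℕ → Prop) : Submodule ℂ S.Hinf :=
  ⨆ χ : {χ : Finset ℕ // χ ⊆ Finset.range n ∧ p χ}, S.labeled χ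

theorem labeled_le_labeledSpan {n : ℕ} {p : Finset ℕ → Prop} {χ : Finset ℕ}
    (h : χ ⊆ Finset.range n) (hp : p χ) : S.labeled χ ≤ S.labeledSpan n p :=
  le_iSup (fun χ : {χ : Finset ℕ // χ ⊆ Finset.range n ∧ p χ} => S.labeled χ) ⟨χ, h, hp⟩

theorem map_topologicalClosure_le (f : S.Hinf →ₗᵢ[ℂ] S.Hinf) (M : Submodule ℂ S.Hinf) :
    Submodule.map f.toLinearMap M.topologicalClosure ≤
      (Submodule.map f.toLinearMap M).topologicalClosure := by
  rintro _ ⟨x, hx, rfl⟩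
  exact map_mem_closure f.continuous hx fun a ha => ⟨a, ha, rfl⟩

/-- A vector that is both in M and orthogonal to M vanishes, so the hypothesis makes the remainder
of the projection onto the closure of M zero. -/
theorem le_topologicalClosure_of_orthogonal {L M : Submodule ℂ S.Hinf}
    (hM : M.topologicalClosure ≤ L) (h : ∀ x ∈ L, x ∈ Mᗮ → x ∈ M) :
    L ≤ M.topologicalClosure := by
  intro x hx
  have hc : CompleteSpace M.topologicalClosure :=
    M.isClosed_topologicalClosure.completeSpace_coe
  have h1 := M.topologicalClosure.starProjection_apply_mem x
  have h2 : x - M.topologicalClosure.starProjection x ∈ Mᗮ :=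
    Submodule.orthogonal_le M.le_topologicalClosure
      (M.topologicalClosure.sub_starProjection_mem_orthogonal x)
  have h3 := h _ (sub_mem hx (hM h1)) h2
  have h4 : x - M.topologicalClosure.starProjection x = 0 :=
    inner_self_eq_zero.1 (h2 _ h3)
  rw [sub_eq_zero.1 h4]
  exact h1

/-- No orthogonality of labels is needed. By induction α_i of the previous level lies in the closed
span of labels with a gap at i; a vector of the next level orthogonal to all labels is thus
orthogonal to all these images, so it belongs to the root space of {0, …, n}, itself one of the
labeled subspaces. -/
theorem level_le_closure_labeledSpan (n : ℕ) :
    S.level n ≤ (S.labeledSpan n fun _ => True).topologicalClosure := by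
  induction n with
  | zero =>
    refine le_trans ?_ (Submodule.le_topologicalClosure _)
    refine le_trans ?_ (labeled_le_labeledSpan (χ := Finset.range 0) le_rfl trivial)
    rw [labeled_range]
    exact le_rfl
  | succ n ih =>
    refine le_topologicalClosure_of_orthogonal ?_ fun x hx hx' => ?_
    · exact Submodule.topologicalClosure_minimal _ (iSup_le fun χ => labeled_le_level χ.2.1)
        (isClosed_level _)
    · have hr : x ∈ S.rootSpace (n + 1) := by
        refine ⟨hx, ?_⟩
        simp only [SetLike.mem_coe, Submodule.mem_iInf]
        intro i
        have h1 : Submodule.map (S.α i).toLinearMap (S.level n) ≤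
            (S.labeledSpan (n + 1) fun _ => True).topologicalClosure := by
          refine (Submodule.map_mono ih).trans ((map_topologicalClosure_le _ _).trans
            (Submodule.topologicalClosure_mono ?_))
          rw [labeledSpan, Submodule.map_iSup]
          refine iSup_le fun χ => ?_
          rw [map_α_labeled]
          exact labeled_le_labeledSpan (gap_subset_range χ.2.1) trivial
        refine Submodule.orthogonal_le h1 ?_
        rwa [Submodule.orthogonal_closure]
      rw [← labeled_range] at hr
      exact labeled_le_labeledSpan (p := fun _ => True) le_rfl trivial hr

/-! ### Normality and complements -/

theorem preservesComplements_iff : S.PreservesComplements ↔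
    ∀ (n i j : ℕ) (hij : i ≤ j) (hj : j ≤ n) (x : S.H (n + 1)),
      (∀ y, inner ℂ (S.δ n i (hij.trans hj) y) x = 0) →
        ∀ y, inner ℂ (S.δ (n + 1) i (by omega) y) (S.δ (n + 1) (j + 1) (by omega) x) = 0 := by
  constructor
  · intro h n i j hij hj x hx y
    refine h n i j hij hj (Submodule.mem_map_of_mem ?_) _ ⟨y, rfl⟩
    rintro _ ⟨z, rfl⟩
    exact hx z
  · rintro h n i j hij hj _ ⟨x, hx, rfl⟩ _ ⟨y, rfl⟩
    exact h n i j hij hj x (fun z => hx _ ⟨z, rfl⟩) y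

variable (S) in
/-- The adjoint of a coface operator. -/
abbrev δadj (n i : ℕ) (hi : i ≤ n) : S.H (n + 1) →L[ℂ] S.H n :=
  ContinuousLinearMap.adjoint (S.δ n i hi).toContinuousLinearMap

theorem inner_δ_left (n i : ℕ) (hi : i ≤ n) (y : S.H n) (x : S.H (n + 1)) :
    inner ℂ (S.δ n i hi y) x = inner ℂ y (S.δadj n i hi x) :=
  (ContinuousLinearMap.adjoint_inner_right (S.δ n i hi).toContinuousLinearMap y x).symm

theorem δadj_δ (n i : ℕ) (hi : i ≤ n) (y : S.H n) : S.δadj n i hi (S.δ n i hi y) = y :=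
  ext_inner_left ℂ fun v => by rw [← inner_δ_left, LinearIsometry.inner_map_map]

theorem Normal.apply (h : S.Normal) (n i j : ℕ) (hij : i ≤ j) (hj : j ≤ n) (x : S.H (n + 1)) :
    S.δ n j hj (S.δadj n i (hij.trans hj) x) =
      S.δadj (n + 1) i (by omega) (S.δ (n + 1) (j + 1) (by omega) x) :=
  congrArg (fun f : S.H (n + 1) →L[ℂ] S.H (n + 1) => f x) (h n i j hij hj)

/-- Both conditions concern the decomposition x = δ_i δ_i^* x + r. On the first summand normality is
the cosimplicial identity together with δ_i^* δ_i = 1; on r it says that δ_i^* δ_{j+1} r = 0. -/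
theorem normal_iff_preservesComplements : S.Normal ↔ S.PreservesComplements := by
  rw [preservesComplements_iff]
  constructor
  · intro h n i j hij hj x hx y
    have h0 : S.δadj n i (hij.trans hj) x = 0 :=
      ext_inner_left ℂ fun v => by rw [← inner_δ_left, hx, inner_zero_right]
    rw [inner_δ_left, ← h.apply n i j hij hj, h0, map_zero, inner_zero_right]
  · intro h n i j hij hj
    ext x
    change S.δ n j hj (S.δadj n i (hij.trans hj) x) =
      S.δadj (n + 1) i (by omega) (S.δ (n + 1) (j + 1) (by omega) x)
    set y := S.δadj n i (hij.trans hj) x with hy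
    have hz := h n i j hij hj (x - S.δ n i (hij.trans hj) y) fun v => by
      rw [inner_δ_left, map_sub, δadj_δ, ← hy, sub_self, inner_zero_right]
    have h1 : S.δadj (n + 1) i (by omega)
        (S.δ (n + 1) (j + 1) (by omega) (x - S.δ n i (hij.trans hj) y)) = 0 :=
      ext_inner_left ℂ fun v => by rw [← inner_δ_left, hz, inner_zero_right]
    rw [map_sub, map_sub, sub_eq_zero, S.δ_comp n i j hij hj, δadj_δ] at h1
    exact h1.symm

/-! ### Orthogonal labeled subspaces give normality -/

theorem LabeledOrthogonal.isOrtho_labeledSpan (h : S.LabeledOrthogonal) {n m : ℕ}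
    {p q : Finset ℕ → Prop} (hpq : ∀ χ, p χ → ¬ q χ) : S.labeledSpan n p ⟂ S.labeledSpan m q := by
  simp only [labeledSpan, Submodule.isOrtho_iSup_left, Submodule.isOrtho_iSup_right]
  intro χ' χ
  exact h _ _ fun he => hpq _ χ.2.2 (he ▸ χ'.2.2)

theorem isOrtho_closure {M N : Submodule ℂ S.Hinf} (h : M ⟂ N) :
    M.topologicalClosure ⟂ N.topologicalClosure := by
  rw [Submodule.isOrtho_iff_le, Submodule.orthogonal_closure]
  exact Submodule.topologicalClosure_minimal _ h (Submodule.isClosed_orthogonal _)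

theorem labeledSpan_true_le (n : ℕ) (p : Finset ℕ → Prop) :
    (S.labeledSpan n fun _ => True) ≤ S.labeledSpan n p ⊔ S.labeledSpan n fun χ => ¬ p χ := by
  refine iSup_le fun χ => ?_
  by_cases hp : p χ
  · exact (labeled_le_labeledSpan χ.2.1 hp).trans le_sup_left
  · exact (labeled_le_labeledSpan (p := fun χ => ¬ p χ) χ.2.1 hp).trans le_sup_right

/-- After subtracting its projection onto the span of the labels with `p`, the vector is orthogonal
to the labels of both kinds, hence by totality to its whole level, which contains it. -/
theorem LabeledOrthogonal.mem_closure_labeledSpan (h : S.LabeledOrthogonal) {n : ℕ}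
    (p : Finset ℕ → Prop) {x : S.Hinf} (hx : x ∈ S.level n)
    (hx' : x ∈ (S.labeledSpan n fun χ => ¬ p χ)ᗮ) :
    x ∈ (S.labeledSpan n p).topologicalClosure := by
  set M := S.labeledSpan n p with hM
  have hMN : M ⟂ S.labeledSpan n fun χ => ¬ p χ := h.isOrtho_labeledSpan fun χ h1 h2 => h2 h1
  have hc : CompleteSpace M.topologicalClosure :=
    M.isClosed_topologicalClosure.completeSpace_coe
  have h1 := M.topologicalClosure.starProjection_apply_mem x
  have hML : M.topologicalClosure ≤ S.level n :=
    Submodule.topologicalClosure_minimal _ (iSup_le fun χ => labeled_le_level χ.2.1)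
      (isClosed_level _)
  have h2 : x - M.topologicalClosure.starProjection x ∈ Mᗮ :=
    Submodule.orthogonal_le M.le_topologicalClosure
      (M.topologicalClosure.sub_starProjection_mem_orthogonal x)
  have h3 : x - M.topologicalClosure.starProjection x ∈ (S.labeledSpan n fun χ => ¬ p χ)ᗮ := by
    refine sub_mem hx' ?_
    exact Submodule.topologicalClosure_minimal _ hMN (Submodule.isClosed_orthogonal _) h1
  have h4 : x - M.topologicalClosure.starProjection x ∈
      (S.labeledSpan n fun _ => True).topologicalClosureᗮ := by
    rw [Submodule.orthogonal_closure]
    refine Submodule.orthogonal_le (labeledSpan_true_le n p) ?_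
    rw [← Submodule.inf_orthogonal]
    exact ⟨h2, h3⟩
  have h5 : x - M.topologicalClosure.starProjection x = 0 :=
    inner_self_eq_zero.1 (h4 _ (level_le_closure_labeledSpan n (sub_mem hx (hML h1))))
  rw [sub_eq_zero.1 h5]
  exact h1

theorem map_α_closure_labeledSpan_le {n i : ℕ} {p q : Finset ℕ → Prop}
    (hpq : ∀ χ, p χ → q (gap i χ)) :
    Submodule.map (S.α i).toLinearMap (S.labeledSpan n p).topologicalClosure ≤
      (S.labeledSpan (n + 1) q).topologicalClosure := by
  refine (map_topologicalClosure_le _ _).trans (Submodule.topologicalClosure_mono ?_)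
  rw [labeledSpan, Submodule.map_iSup]
  refine iSup_le fun χ => ?_
  rw [map_α_labeled]
  exact labeled_le_labeledSpan (gap_subset_range χ.2.1) (hpq _ χ.2.2)

theorem LabeledOrthogonal.preservesComplements (h : S.LabeledOrthogonal) :
    S.PreservesComplements := by
  rw [preservesComplements_iff]
  intro n i j hij hj x hx y
  -- A label without i arises by inserting a gap at i, so its subspace lies in the range of α_i on
  -- the level below, to which x is orthogonal.
  have h1 : S.ι (n + 1) x ∈ (S.labeledSpan (n + 1) fun χ => i ∈ χ).topologicalClosure := by
    refine h.mem_closure_labeledSpan _ (ι_mem_level _ x) ?_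
    have hle : (S.labeledSpan (n + 1) fun χ => ¬ i ∈ χ) ≤
        Submodule.map (S.α i).toLinearMap (S.level n) := by
      refine iSup_le fun χ => ?_
      obtain ⟨χ', h1, h2⟩ := exists_gap_eq (hij.trans hj) χ.2.1 χ.2.2
      rw [← h2, ← map_α_labeled]
      exact Submodule.map_mono (labeled_le_level h1)
    refine Submodule.orthogonal_le hle ?_
    rintro _ ⟨_, ⟨z, rfl⟩, rfl⟩
    change inner ℂ (S.α i (S.ι n z)) _ = 0
    rw [S.α_ι n i (hij.trans hj), LinearIsometry.inner_map_map, hx]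
  -- A gap at j + 1 > i does not affect membership of i, while a gap at i removes it: the two images
  -- involve disjoint sets of labels.
  have h2 := map_α_closure_labeledSpan_le (i := j + 1) (q := fun χ => i ∈ χ)
    (fun χ hχ => (mem_gap_of_lt (by omega)).2 hχ) (Submodule.mem_map_of_mem h1)
  have h3 := map_α_closure_labeledSpan_le (i := i) (q := fun χ => i ∉ χ)
    (fun χ _ => notMem_gap i χ)
    (Submodule.mem_map_of_mem (level_le_closure_labeledSpan (n + 1) (ι_mem_level _ y)))
  have h4 := (isOrtho_closure (h.isOrtho_labeledSpan (n := n + 1 + 1) (m := n + 1 + 1)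
    (p := fun χ => i ∉ χ) (q := fun χ => i ∈ χ) fun χ h1 h2 => h1 h2)).inner_eq h3 h2
  change inner ℂ (S.α i (S.ι (n + 1) y)) (S.α (j + 1) (S.ι (n + 1) x)) = 0 at h4
  rwa [S.α_ι (n + 1) i (by omega), S.α_ι (n + 1) (j + 1) (by omega),
    LinearIsometry.inner_map_map] at h4

/-! ### Consequences of normality in `H_∞` -/

variable (S) in
/-- The adjoint of a partial shift. -/
abbrev αadj (i : ℕ) : S.Hinf →L[ℂ] S.Hinf :=
  ContinuousLinearMap.adjoint (S.α i).toContinuousLinearMap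

theorem inner_α_left (i : ℕ) (y x : S.Hinf) : inner ℂ (S.α i y) x = inner ℂ y (S.αadj i x) :=
  (ContinuousLinearMap.adjoint_inner_right (S.α i).toContinuousLinearMap y x).symm

/-- The union of the tower above any level is dense. -/
theorem dense_induction (N : ℕ) {p : S.Hinf → Prop} (hp : IsClosed {x | p x})
    (h : ∀ n, N ≤ n → ∀ x : S.H n, p (S.ι n x)) (x : S.Hinf) : p x := by
  have : (⋃ n, Set.range (S.ι n)) ⊆ {x | p x} := by
    refine Set.iUnion_subset fun n => ?_
    rintro _ ⟨z, rfl⟩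
    obtain ⟨w, hw⟩ := S.exists_ι_eq (le_max_left n N) z
    rw [← hw]
    exact h _ (le_max_right n N) w
  exact hp.closure_subset_iff.2 this (S.dense_iUnion_range_ι x)

/-- Climb the tower one level at a time: the new part of x is orthogonal to level m, and by
normality α_i of it is orthogonal to level m + 1. -/
theorem Normal.starProjection_α_ι (h : S.Normal) {n i : ℕ} (hi : i ≤ n) (x : S.Hinf) :
    (S.level (n + 1)).starProjection (S.α i x) = S.α i ((S.level n).starProjection x) := by
  induction x using dense_induction n with
  | hp => exact isClosed_eq (by fun_prop) (by fun_prop)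
  | h m hm x =>
    induction m, hm using Nat.le_induction with
    | base =>
      rw [Submodule.starProjection_eq_self_iff.2 (α_mem_level i (ι_mem_level n x)),
        Submodule.starProjection_eq_self_iff.2 (ι_mem_level n x)]
    | succ m hm ih =>
      have hi' : i ≤ m := hi.trans hm
      set e := S.δadj m m le_rfl x with he
      have h1 : x - S.δ m m le_rfl e ∈ (LinearMap.range (S.emb m).toLinearMap)ᗮ := by
        rintro _ ⟨v, rfl⟩
        change inner ℂ (S.δ m m le_rfl v) _ = 0
        rw [inner_δ_left, map_sub, δadj_δ, ← he, sub_self, inner_zero_right]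
      have hx : S.ι (m + 1) x = S.ι m e + S.ι (m + 1) (x - S.δ m m le_rfl e) := by
        rw [map_sub, ← S.ι_emb m e]
        exact (add_sub_cancel _ _).symm
      have h2 : (S.level n).starProjection (S.ι (m + 1) (x - S.δ m m le_rfl e)) = 0 := by
        refine Submodule.eq_starProjection_of_mem_orthogonal (zero_mem _) ?_
        rw [sub_zero]
        intro v hv
        obtain ⟨v, rfl⟩ := level_mono hm hv
        change inner ℂ (S.ι m v) _ = 0
        rw [← S.ι_emb, LinearIsometry.inner_map_map]
        exact h1 _ ⟨v, rfl⟩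
      have h3 : (S.level (n + 1)).starProjection
          (S.α i (S.ι (m + 1) (x - S.δ m m le_rfl e))) = 0 := by
        refine Submodule.eq_starProjection_of_mem_orthogonal (zero_mem _) ?_
        rw [sub_zero]
        intro v hv
        obtain ⟨v, rfl⟩ := level_mono (Nat.succ_le_succ hm) hv
        change inner ℂ (S.ι (m + 1) v) _ = 0
        rw [S.α_ι (m + 1) i (by omega), ← S.ι_emb, LinearIsometry.inner_map_map,
          ← inner_conj_symm, inner_δ_left]
        change starRingEnd ℂ (inner ℂ _ (S.δadj (m + 1) i _ (S.δ (m + 1) (m + 1) le_rfl v))) = 0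
        -- Normality turns δ_i^* δ_{m+1} v into δ_m δ_i^* v, a vector in the range of the inclusion
        -- δ_m, to which the new part is orthogonal.
        rw [← h.apply m i m hi' le_rfl v, inner_conj_symm]
        exact h1 _ ⟨_, rfl⟩
      rw [hx, map_add, map_add, map_add, map_add, h3, h2, map_zero, add_zero, add_zero, ih]

/-- Testing against an arbitrary z in H_∞ reduces to testing against its projection to level n,
because α_i intertwines the projections of consecutive levels. So the adjoint of the partial shift
does not leave the tower. -/
theorem Normal.αadj_ι (h : S.Normal) (n i : ℕ) (hi : i ≤ n) (w : S.H (n + 1)) :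
    S.αadj i (S.ι (n + 1) w) = S.ι n (S.δadj n i hi w) := by
  refine ext_inner_left ℂ fun z => ?_
  obtain ⟨u, hu⟩ := (S.level n).starProjection_apply_mem z
  change S.ι n u = _ at hu
  rw [← inner_α_left, ← Submodule.starProjection_eq_self_iff.2 (ι_mem_level (n + 1) w),
    ← Submodule.inner_starProjection_left_eq_right, h.starProjection_α_ι hi, ← hu, S.α_ι n i hi,
    LinearIsometry.inner_map_map, inner_δ_left,
    ← Submodule.starProjection_eq_self_iff.2 (ι_mem_level n (S.δadj n i hi w)),
    ← Submodule.inner_starProjection_left_eq_right, ← hu, LinearIsometry.inner_map_map]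

/-- The partial shifts of a normal semi-cosimplicial Hilbert space satisfy the relation of
normality. -/
theorem Normal.α_αadj (h : S.Normal) {i j : ℕ} (hij : i ≤ j) (x : S.Hinf) :
    S.α j (S.αadj i x) = S.αadj i (S.α (j + 1) x) := by
  induction x using dense_induction (j + 1) with
  | hp => exact isClosed_eq (by fun_prop) (by fun_prop)
  | h m hm x =>
    obtain ⟨n, rfl⟩ : ∃ n, m = n + 1 := ⟨m - 1, by omega⟩
    rw [h.αadj_ι n i (by omega), S.α_ι n j (by omega), S.α_ι (n + 1) (j + 1) (by omega),
      h.αadj_ι (n + 1) i (by omega), h.apply n i j hij (by omega)]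

/-- If α_n x = x, applying P_{m+1} α_n = α_n P_m repeatedly shows that all projections P_m x with m
≥ n equal P_n x; by density of the tower x = P_n x. -/
theorem Normal.saturated (h : S.Normal) : S.Saturated := by
  intro n
  apply le_antisymm
  · intro x hx
    exact α_eq_self le_rfl hx
  · intro x hx
    rw [mem_fixed] at hx
    have h1 : ∀ m, n ≤ m → (S.level m).starProjection x = (S.level n).starProjection x := by
      intro m hm
      induction m, hm using Nat.le_induction with
      | base => rfl
      | succ m hm ih =>
        have h2 := h.starProjection_α_ι hm x
        rw [hx, ih] at h2
        rw [h2]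
        exact α_eq_self le_rfl ((S.level n).starProjection_apply_mem x)
    have h3 : ∀ y, inner ℂ y (x - (S.level n).starProjection x) = 0 := by
      intro y
      induction y using dense_induction n with
      | hp => exact isClosed_eq (by fun_prop) (by fun_prop)
      | h m hm y =>
        rw [← h1 m hm]
        exact (S.level m).sub_starProjection_mem_orthogonal x _ (ι_mem_level m y)
    have h4 := sub_eq_zero.1 (inner_self_eq_zero.1 (h3 _))
    rw [h4]
    exact (S.level n).starProjection_apply_mem x

/-! ### Orthogonality of labeled subspaces from normality -/

theorem Normal.orthogonal_of_mem_rootSpace (h : S.Normal) {r i : ℕ} (hi : i < r) {x : S.Hinf}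
    (hx : x ∈ S.rootSpace r) : S.αadj i x = 0 := by
  obtain ⟨r, rfl⟩ : ∃ k, r = k + 1 := ⟨r - 1, by omega⟩
  obtain ⟨⟨w, rfl⟩, hx⟩ := hx
  simp only [SetLike.mem_coe, Submodule.mem_iInf] at hx
  change S.αadj i (S.ι (r + 1) w) = 0
  rw [h.αadj_ι r i (by omega)]
  have : S.δadj r i (by omega) w = 0 := by
    refine ext_inner_left ℂ fun v => ?_
    have h1 := hx i _ ⟨_, ι_mem_level r v, rfl⟩
    change inner ℂ (S.α i (S.ι r v)) (S.ι (r + 1) w) = 0 at h1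
    rw [S.α_ι r i (by omega), LinearIsometry.inner_map_map, inner_δ_left] at h1
    rw [h1, inner_zero_right]
  rw [this, map_zero]

/-- The second alternative strengthens the induction: once the positions below N are decided, the
remaining elements of χ provisionally occupy the positions from N on without gaps, and the adjoints
at these positions kill the vector too. For N = 0 this is the root space property. -/
theorem Normal.αadj_gapShift (h : S.Normal) (χ : Finset ℕ) {x : S.Hinf}
    (hx : x ∈ S.rootSpace χ.card) (N i : ℕ)
    (hi : i < N ∧ i ∈ χ ∨ N ≤ i ∧ i < N + (χ \ Finset.range N).card) :
    S.αadj i (S.gapShift χ N x) = 0 := by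
  induction N generalizing i with
  | zero =>
    refine h.orthogonal_of_mem_rootSpace ?_ hx
    simpa using hi
  | succ N ih =>
    by_cases hc : N ∈ χ
    · have h1 := card_sdiff_range_of_mem hc
      rw [gapShift_succ_of_mem hc]
      refine ih i ?_
      rcases hi with ⟨h2, h3⟩ | h2
      · rcases (Nat.lt_succ_iff_lt_or_eq.1 h2) with h4 | rfl
        · exact Or.inl ⟨h4, h3⟩
        · exact Or.inr ⟨le_rfl, by omega⟩
      · exact Or.inr ⟨by omega, by omega⟩
    · have h1 := card_sdiff_range_of_notMem hc
      rw [gapShift_succ_of_notMem hc, LinearIsometry.coe_mul, Function.comp_apply]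
      have hne : i ≠ N := by
        rintro rfl
        rcases hi with ⟨_, h3⟩ | h2
        · exact hc h3
        · omega
      rcases lt_or_gt_of_ne hne with hlt | hgt
      · obtain ⟨M, rfl⟩ : ∃ M, N = M + 1 := ⟨N - 1, by omega⟩
        -- For i < N normality reads α_i^* α_N = α_{N-1} α_i^*.
        rw [← h.α_αadj (by omega), ih i, map_zero]
        rcases hi with ⟨_, h3⟩ | h2
        · exact Or.inl ⟨hlt, h3⟩
        · omega
      · obtain ⟨k, rfl⟩ : ∃ k, i = k + 1 := ⟨i - 1, by omega⟩
        -- For i = k + 1 > N the adjoint form of normality, α_{k+1}^* α_N = α_N α_k^*, lowers the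
        -- index to k; it is obtained by moving everything to the other side of the inner product.
        have hz := ih k (Or.inr (by omega))
        refine ext_inner_left ℂ fun v => ?_
        rw [← inner_α_left, ← inner_conj_symm, inner_α_left, ← h.α_αadj (by omega),
          inner_conj_symm, inner_α_left, hz, inner_zero_right, inner_zero_right]

theorem Normal.αadj_eq_zero_of_mem_labeled (h : S.Normal) {χ : Finset ℕ} {i : ℕ} (hi : i ∈ χ)
    {x : S.Hinf} (hx : x ∈ S.labeled χ) : S.αadj i x = 0 := by
  obtain ⟨x, hx, rfl⟩ := hx
  change S.αadj i (S.labelShift χ x) = 0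
  rw [labelShift_eq_gapShift (subset_range_sup χ) (rootSpace_le_level _ hx)]
  exact h.αadj_gapShift χ hx _ i (Or.inl ⟨Finset.mem_range.1 (subset_range_sup χ hi), hi⟩)

theorem exists_α_eq_of_mem_labeled {χ : Finset ℕ} {i : ℕ} (hi : i ∉ χ) {x : S.Hinf}
    (hx : x ∈ S.labeled χ) : ∃ y, S.α i y = x := by
  obtain ⟨χ', -, rfl⟩ := exists_gap_eq (le_max_left i (χ.sup id))
    ((subset_range_sup χ).trans
      (Finset.range_mono (Nat.succ_le_succ (le_max_right i (χ.sup id))))) hi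
  rw [← map_α_labeled] at hx
  obtain ⟨y, -, hy⟩ := hx
  exact ⟨y, hy⟩

theorem Normal.isOrtho_labeled (h : S.Normal) {χ χ' : Finset ℕ} {i : ℕ} (hi : i ∉ χ)
    (hi' : i ∈ χ') : S.labeled χ ⟂ S.labeled χ' := by
  rw [Submodule.isOrtho_iff_inner_eq]
  intro x hx y hy
  obtain ⟨z, rfl⟩ := exists_α_eq_of_mem_labeled hi hx
  rw [inner_α_left, h.αadj_eq_zero_of_mem_labeled hi' hy, inner_zero_right]

theorem Normal.labeledOrthogonal (h : S.Normal) : S.LabeledOrthogonal := by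
  intro χ χ' hne
  obtain ⟨i, hi⟩ := not_forall.1 (mt Finset.ext hne)
  by_cases h1 : i ∈ χ
  · exact (h.isOrtho_labeled (fun h2 => hi (iff_of_true h1 h2)) h1).symm
  · exact h.isOrtho_labeled h1 (by_contra fun h2 => hi (iff_of_false h1 h2))

end SCH

/-! ### Canonical semi-cosimplicial Hilbert spaces are normal -/

/-- `braidDesc n d = σ_{n+d} ⋯ σ_{n+2} σ_{n+1}`. -/
def braidDesc (n : ℕ) : ℕ → BraidInf
  | 0 => 1
  | d + 1 => artin (n + d) * braidDesc n d

theorem artin_mul_braidDesc (m n d : ℕ) (h : n + d < m) :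
    artin m * braidDesc n d = braidDesc n d * artin m := by
  induction d with
  | zero => simp [braidDesc]
  | succ d ih =>
    rw [braidDesc, ← mul_assoc, ← artin_comm (n + d) m (by omega), mul_assoc, ih (by omega),
      mul_assoc]

theorem artin_mul_braidDesc_eq (n k d : ℕ) (h : k + 1 < d) :
    artin (n + k) * braidDesc n d = braidDesc n d * artin (n + k + 1) := by
  induction d with
  | zero => omega
  | succ d ih =>
    by_cases hk : k + 1 < d
    · rw [braidDesc, ← mul_assoc, artin_comm (n + k) (n + d) (by omega), mul_assoc, ih hk,
        mul_assoc]
    · obtain rfl : d = k + 1 := by omega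
      rw [braidDesc, braidDesc, ← add_assoc, ← mul_assoc, ← mul_assoc, artin_braid, mul_assoc,
        artin_mul_braidDesc _ _ _ (by omega)]
      simp only [mul_assoc]

section canonical

variable {K : Type u} [NormedAddCommGroup K] [InnerProductSpace ℂ K]
  (ρ : BraidInf →* (K ≃ₗᵢ[ℂ] K))

theorem rep_mul_apply (g h : BraidInf) (x : K) : ρ (g * h) x = ρ g (ρ h x) := by
  rw [map_mul, LinearIsometryEquiv.coe_mul, Function.comp_apply]

theorem rep_apply_inv_apply (g : BraidInf) (x : K) : ρ g (ρ g⁻¹ x) = x := by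
  rw [← rep_mul_apply, mul_inv_cancel, map_one, LinearIsometryEquiv.coe_one, id]

theorem rep_inv_mem_braidFixed {n : ℕ} {g : BraidInf}
    (hg : ∀ m, n ≤ m → artin m * g = g * artin m) {x : K} (hx : x ∈ braidFixed ρ n) :
    ρ g⁻¹ x ∈ braidFixed ρ n := by
  rw [mem_braidFixed] at *
  intro m hm
  rw [← rep_mul_apply, (Commute.inv_right (hg m hm : Commute _ _)).eq, rep_mul_apply, hx m hm]

/-- All letters of the word except the rightmost can be moved to x, which they fix. -/
theorem inner_braidDesc {n d : ℕ} (z : K) {x : K} (hx : x ∈ braidFixed ρ (n + 1)) :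
    inner ℂ (ρ (braidDesc n (d + 1)) z) x = inner ℂ (ρ (artin n) z) x := by
  induction d with
  | zero => simp [braidDesc]
  | succ d ih =>
    rw [braidDesc, rep_mul_apply]
    nth_rw 1 [← (mem_braidFixed ρ).1 hx (n + (d + 1)) (by omega)]
    rw [LinearIsometryEquiv.inner_map_map, ih]

theorem braidDesc_fixed {n k d : ℕ} (h : k + 1 < d) {z : K} (hz : z ∈ braidFixed ρ (n + 1)) :
    ρ (artin (n + k)) (ρ (braidDesc n d) z) = ρ (braidDesc n d) z := by
  rw [← rep_mul_apply, artin_mul_braidDesc_eq n k d h, rep_mul_apply,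
    (mem_braidFixed ρ).1 hz (n + k + 1) (by omega)]

/-- The vectors fixed by `σ_{n+1}, …, σ_{n+d-1}`. -/
def braidFixedBelow (n d : ℕ) : Submodule ℂ K :=
  ⨅ k : {k : ℕ // k + 1 < d},
    LinearMap.eqLocus (ρ (artin (n + k))).toLinearEquiv.toLinearMap LinearMap.id

theorem mem_braidFixedBelow {n d : ℕ} {x : K} :
    x ∈ braidFixedBelow ρ n d ↔ ∀ k, k + 1 < d → ρ (artin (n + k)) x = x := by
  simp only [braidFixedBelow, Submodule.mem_iInf, Subtype.forall]
  rfl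

theorem isClosed_braidFixedBelow (n d : ℕ) : IsClosed (braidFixedBelow ρ n d : Set K) := by
  have : (braidFixedBelow ρ n d : Set K) =
      ⋂ k : {k : ℕ // k + 1 < d}, {x | ρ (artin (n + k)) x = x} := by
    ext x
    simp [mem_braidFixedBelow]
  rw [this]
  exact isClosed_iInter fun k => isClosed_eq (ρ (artin (n + k))).continuous continuous_id

/-- The inner product equals that of x with the longer words applied to z, which lie in
`braidFixedBelow ρ n (d + 1)`. These spaces decrease to the fixed space of all the generators, to
which x is orthogonal, so x is approximated by vectors orthogonal to them. -/
theorem inner_artin_eq_zero [CompleteSpace K] {n : ℕ} {x z : K} (hx : x ∈ braidFixed ρ (n + 1))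
    (hx' : x ∈ (braidFixed ρ n)ᗮ) (hz : z ∈ braidFixed ρ (n + 1)) :
    inner ℂ (ρ (artin n) z) x = 0 := by
  set U : ℕ → Submodule ℂ K := fun d => (braidFixedBelow ρ n d)ᗮ with hU
  have hmono : Monotone U := fun a b hab => Submodule.orthogonal_le fun y hy =>
    (mem_braidFixedBelow ρ).2 fun k hk => (mem_braidFixedBelow ρ).1 hy k (by omega)
  have hc : CompleteSpace (⨆ d, U d).topologicalClosure :=
    (⨆ d, U d).isClosed_topologicalClosure.completeSpace_coe
  have hxU : x ∈ (⨆ d, U d).topologicalClosure := by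
    rw [← Submodule.orthogonal_orthogonal_eq_closure]
    refine Submodule.orthogonal_le (fun y hy => ?_) hx'
    rw [← Submodule.iInf_orthogonal, Submodule.mem_iInf] at hy
    refine (mem_braidFixed ρ).2 fun m hm => ?_
    -- The index `m - n + 2` is the first for which the generator `artin m` is among those required
    -- to fix the vector.
    have h1 := hy (m - n + 2)
    rw [hU, Submodule.orthogonal_orthogonal_eq_closure,
      IsClosed.submodule_topologicalClosure_eq (isClosed_braidFixedBelow ρ n _)] at h1
    have h2 := (mem_braidFixedBelow ρ).1 h1 (m - n) (by omega)
    rwa [show n + (m - n) = m by omega] at h2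
  have ht := Submodule.starProjection_tendsto_closure_iSup U hmono x
  rw [Submodule.starProjection_eq_self_iff.2 hxU] at ht
  have hle : ∀ d, ‖(inner ℂ (ρ (artin n) z) x : ℂ)‖ ≤
      ‖z‖ * ‖x - (U (d + 1)).starProjection x‖ := by
    intro d
    have h0 : inner ℂ (ρ (braidDesc n (d + 1)) z) ((U (d + 1)).starProjection x) = 0 :=
      (U (d + 1)).starProjection_apply_mem x _
        ((mem_braidFixedBelow ρ).2 fun k hk => braidDesc_fixed ρ hk hz)
    rw [← inner_braidDesc ρ (d := d) z hx, ← sub_zero (inner ℂ _ x), ← h0, ← inner_sub_right]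
    exact (norm_inner_le_norm _ _).trans_eq (by rw [LinearIsometryEquiv.norm_map])
  have ht' : Tendsto (fun d => ‖z‖ * ‖x - (U (d + 1)).starProjection x‖) atTop (𝓝 0) := by
    have := ((tendsto_const_nhds (x := x)).sub
      ((tendsto_add_atTop_iff_nat 1).2 ht)).norm.const_mul ‖z‖
    simpa using this
  exact norm_le_zero_iff.1 (ge_of_tendsto' ht' hle)

theorem canonicalSCH_preservesComplements [CompleteSpace K] :
    (canonicalSCH ρ).PreservesComplements := by
  rw [SCH.preservesComplements_iff]
  intro n i j hij hj x hx y
  obtain ⟨x, hxm⟩ := x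
  obtain ⟨y, hym⟩ := y
  change x ∈ braidFixed ρ (n + 1) at hxm
  change y ∈ braidFixed ρ (n + 1) at hym
  have hx : ∀ y ∈ braidFixed ρ n, inner ℂ (ρ (braidProd i (n - i)) y) x = 0 :=
    fun y hy => hx ⟨y, hy⟩
  change inner ℂ (ρ (braidProd i (n + 1 - i)) y)
    (ρ (braidProd (j + 1) (n + 1 - (j + 1))) x) = 0
  -- The words b and h' use only generators commuting with those of index at least n + 1, so they
  -- preserve `braidFixed ρ (n + 1)`. Writing y = b y', the braid identity pulls the word applied to
  -- x out of the other argument too, where it cancels; removing h' then leaves the single generator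
  -- `artin n`.
  set b := braidProd j (n - j) with hb
  set h' := braidProd i (n - i) with hh'
  have hh : braidProd i (n + 1 - i) = h' * artin n := by
    rw [show n + 1 - i = (n - i) + 1 by omega, braidProd, show i + (n - i) = n by omega]
  have hgh := braidProd_mul_braidProd i j (n + 1 - i) hij (n - j) (by omega)
  have hy' : ρ b⁻¹ y ∈ braidFixed ρ (n + 1) :=
    rep_inv_mem_braidFixed ρ (fun m hm => artin_mul_braidProd m j (n - j) (by omega)) hym
  have hx' : ρ h'⁻¹ x ∈ braidFixed ρ (n + 1) :=
    rep_inv_mem_braidFixed ρ (fun m hm => artin_mul_braidProd m i (n - i) (by omega)) hxm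
  have hx'' : ρ h'⁻¹ x ∈ (braidFixed ρ n)ᗮ := fun y hy => by
    rw [← (ρ h').inner_map_map, rep_apply_inv_apply]
    exact hx y hy
  rw [show n + 1 - (j + 1) = n - j by omega, ← rep_apply_inv_apply ρ b y, ← rep_mul_apply, ← hgh,
    rep_mul_apply, LinearIsometryEquiv.inner_map_map, hh, rep_mul_apply,
    ← rep_apply_inv_apply ρ h' x, LinearIsometryEquiv.inner_map_map]
  exact inner_artin_eq_zero ρ hx' hx'' hy'

end canonical

namespace SCH

variable {S T R : SCH.{u}}

/-! ### Unitary equivalence -/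

theorem UnitarilyEquivalent.symm (h : S.UnitarilyEquivalent T) : T.UnitarilyEquivalent S := by
  obtain ⟨U, hU⟩ := h
  refine ⟨fun n => (U n).symm, fun n i hi x => ?_⟩
  rw [LinearIsometryEquiv.eq_symm_apply, ← hU, LinearIsometryEquiv.apply_symm_apply]

theorem UnitarilyEquivalent.trans (h : S.UnitarilyEquivalent T) (h' : T.UnitarilyEquivalent R) :
    S.UnitarilyEquivalent R := by
  obtain ⟨U, hU⟩ := h
  obtain ⟨V, hV⟩ := h'
  refine ⟨fun n => (U n).trans (V n), fun n i hi x => ?_⟩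
  rw [LinearIsometryEquiv.trans_apply, hV, hU, LinearIsometryEquiv.trans_apply]

theorem UnitarilyEquivalent.isCanonicalBraid_iff (h : S.UnitarilyEquivalent T) :
    S.IsCanonicalBraid ↔ T.IsCanonicalBraid := by
  constructor
  · rintro ⟨K, i1, i2, i3, ρ, hρ⟩
    exact ⟨K, i1, i2, i3, ρ, h.symm.trans hρ⟩
  · rintro ⟨K, i1, i2, i3, ρ, hρ⟩
    exact ⟨K, i1, i2, i3, ρ, h.trans hρ⟩

theorem UnitarilyEquivalent.isCanonicalSym_iff (h : S.UnitarilyEquivalent T) :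
    S.IsCanonicalSym ↔ T.IsCanonicalSym := by
  constructor
  · rintro ⟨K, i1, i2, i3, ρ, hρ⟩
    exact ⟨K, i1, i2, i3, ρ, h.symm.trans hρ⟩
  · rintro ⟨K, i1, i2, i3, ρ, hρ⟩
    exact ⟨K, i1, i2, i3, ρ, h.trans hρ⟩

theorem IsCanonicalSym.isCanonicalBraid (h : S.IsCanonicalSym) : S.IsCanonicalBraid := by
  obtain ⟨K, i1, i2, i3, ρ, hρ⟩ := h
  exact ⟨K, i1, i2, i3, ρ.comp braidToSym, hρ⟩

theorem UnitarilyEquivalent.preservesComplements (h : S.UnitarilyEquivalent T)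
    (hT : T.PreservesComplements) : S.PreservesComplements := by
  obtain ⟨U, hU⟩ := h
  rw [preservesComplements_iff] at *
  intro n i j hij hj x hx y
  rw [← (U (n + 1 + 1)).inner_map_map, ← hU, ← hU]
  refine hT n i j hij hj _ (fun z => ?_) _
  rw [← (U n).apply_symm_apply z, hU, LinearIsometryEquiv.inner_map_map, hx]

theorem IsCanonicalBraid.normal (h : S.IsCanonicalBraid) : S.Normal := by
  obtain ⟨K, i1, i2, i3, ρ, hρ⟩ := h
  exact normal_iff_preservesComplements.2
    (hρ.preservesComplements (canonicalSCH_preservesComplements ρ))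

/-- The unitary from the space of level `n - 1` onto its image in `H_∞`. -/
def levelEquiv (S : SCH.{u}) (n : ℕ) : S.H n ≃ₗᵢ[ℂ] S.level n where
  toLinearEquiv := LinearEquiv.ofInjective (S.ι n).toLinearMap (S.ι n).injective
  norm_map' x := (S.ι n).norm_map x

theorem Saturated.unitarilyEquivalent (h : S.Saturated) : S.UnitarilyEquivalent S.saturation :=
  ⟨fun n => (S.levelEquiv n).trans (LinearIsometryEquiv.ofEq _ _ (h n)),
    fun n i hi x => Subtype.ext (S.α_ι n i hi x)⟩

/-! ### The representation of `S_∞` of a normal semi-cosimplicial Hilbert space -/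

theorem level_le_of_labeled_le {n : ℕ} {M : Submodule ℂ S.Hinf} (hM : IsClosed (M : Set S.Hinf))
    (h : ∀ χ ⊆ Finset.range n, S.labeled χ ≤ M) : S.level n ≤ M :=
  (level_le_closure_labeledSpan n).trans
    (Submodule.topologicalClosure_minimal _ (iSup_le fun χ => h χ χ.2.1) hM)

theorem top_le_of_labeled_le {M : Submodule ℂ S.Hinf} (hM : IsClosed (M : Set S.Hinf))
    (h : ∀ χ, S.labeled χ ≤ M) : ⊤ ≤ M := by
  rw [← dense_iSup_level]
  exact Submodule.topologicalClosure_minimal _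
    (iSup_le fun n => level_le_of_labeled_le hM fun χ _ => h χ) hM

variable (S) in
/-- The isometries of the root spaces onto the labeled subspaces, with labels permuted by `π`. -/
def permShift (π : Equiv.Perm ℕ) (χ : Finset ℕ) : S.rootSpace χ.card →ₗᵢ[ℂ] S.Hinf :=
  (S.labelShift (χ.map π.toEmbedding)).comp (S.rootSpace χ.card).subtypeₗᵢ

theorem range_permShift (π : Equiv.Perm ℕ) (χ : Finset ℕ) :
    LinearMap.range (S.permShift π χ).toLinearMap = S.labeled (χ.map π.toEmbedding) := by
  ext y
  constructor
  · rintro ⟨x, rfl⟩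
    exact ⟨x, by rw [Finset.card_map]; exact x.2, rfl⟩
  · rintro ⟨x, hx, rfl⟩
    rw [Finset.card_map] at hx
    exact ⟨⟨x, hx⟩, rfl⟩

/-- Relabeling by π merely permutes the orthogonal total family of labeled subspaces, and preserves
ranks, so the same root spaces serve as summands. -/
theorem Normal.isHilbertSum_permShift (h : S.Normal) (π : Equiv.Perm ℕ) :
    IsHilbertSum ℂ (fun χ : Finset ℕ => S.rootSpace χ.card) (S.permShift π) := by
  refine IsHilbertSum.mk ?_ (top_le_of_labeled_le (Submodule.isClosed_topologicalClosure _) ?_)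
  · intro χ χ' hne x y
    refine (h.labeledOrthogonal (χ.map π.toEmbedding) (χ'.map π.toEmbedding) fun he =>
      hne (Finset.map_injective _ he)).inner_eq ?_ ?_
    · rw [← range_permShift]
      exact ⟨x, rfl⟩
    · rw [← range_permShift]
      exact ⟨y, rfl⟩
  · intro χ
    refine le_trans ?_ (Submodule.le_topologicalClosure _)
    refine le_trans (le_of_eq ?_) (le_iSup _ (χ.map π.symm.toEmbedding))
    rw [range_permShift, Finset.map_map]
    congr 1
    ext m
    simp

/-- The unitary on `H_∞` that permutes the labels. -/
def Normal.permUnitary (h : S.Normal) (π : Equiv.Perm ℕ) : S.Hinf ≃ₗᵢ[ℂ] S.Hinf :=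
  (h.isHilbertSum_permShift 1).linearIsometryEquiv.trans
    (h.isHilbertSum_permShift π).linearIsometryEquiv.symm

theorem Normal.permUnitary_labelShift (h : S.Normal) (π : Equiv.Perm ℕ) (χ : Finset ℕ)
    {x : S.Hinf} (hx : x ∈ S.rootSpace χ.card) :
    h.permUnitary π (S.labelShift χ x) = S.labelShift (χ.map π.toEmbedding) x := by
  have h1 : S.labelShift χ x = S.permShift 1 χ ⟨x, hx⟩ := by
    change _ = S.labelShift (χ.map (Equiv.toEmbedding 1)) x
    congr 2
    ext m
    rw [Finset.mem_map_equiv]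
    rfl
  rw [permUnitary, LinearIsometryEquiv.trans_apply, h1,
    ← (h.isHilbertSum_permShift 1).linearIsometryEquiv_symm_apply_single,
    LinearIsometryEquiv.apply_symm_apply,
    (h.isHilbertSum_permShift π).linearIsometryEquiv_symm_apply_single]
  rfl

/-- The unitary representation of `S_∞` on `H_∞` by permutations of labels. -/
def Normal.rep (h : S.Normal) : SymInf →* (S.Hinf ≃ₗᵢ[ℂ] S.Hinf) :=
  MonoidHom.mk' (fun π => h.permUnitary π) (by
    intro π τ
    ext x
    have hle : ⊤ ≤ LinearMap.eqLocus
        (h.permUnitary (π * τ : SymInf)).toLinearEquiv.toLinearMap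
        ((h.permUnitary π).toLinearEquiv.toLinearMap ∘ₗ
          (h.permUnitary τ).toLinearEquiv.toLinearMap) := by
      refine top_le_of_labeled_le (isClosed_eq (h.permUnitary (π * τ : SymInf)).continuous
        ((h.permUnitary π).continuous.comp (h.permUnitary τ).continuous)) ?_
      rintro χ _ ⟨x, hx, rfl⟩
      change h.permUnitary (π * τ : SymInf) (S.labelShift χ x) =
        h.permUnitary π (h.permUnitary τ (S.labelShift χ x))
      rw [h.permUnitary_labelShift _ _ hx, h.permUnitary_labelShift _ _ hx,
        h.permUnitary_labelShift _ _ (by rwa [Finset.card_map]), Finset.map_map]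
      rfl
    exact hle (Submodule.mem_top (x := x)))

theorem Normal.rep_labelShift (h : S.Normal) (π : SymInf) (χ : Finset ℕ) {x : S.Hinf}
    (hx : x ∈ S.rootSpace χ.card) :
    h.rep π (S.labelShift χ x) = S.labelShift (χ.map (π : Equiv.Perm ℕ).toEmbedding) x :=
  h.permUnitary_labelShift π χ hx

theorem braidToSym_artin (m : ℕ) : braidToSym (artin m) = transp m :=
  PresentedGroup.toGroup.of _

/-- `σ_{i+1} ⋯ σ_{i+d}` acts on `{0, …, i + d - 1}` by inserting a gap at `i`. -/
theorem braidToSym_braidProd_apply (i d c : ℕ) (hc : c < i + d) :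
    (braidToSym (braidProd i d) : Equiv.Perm ℕ) c = gapMap i c := by
  have hfix : ∀ d c, i + d < c → (braidToSym (braidProd i d) : Equiv.Perm ℕ) c = c := by
    intro d c hc
    induction d with
    | zero => simp [braidProd]
    | succ d ih =>
      rw [braidProd, map_mul, braidToSym_artin, Subgroup.coe_mul, Equiv.Perm.mul_apply]
      change (braidToSym (braidProd i d) : Equiv.Perm ℕ)
        (Equiv.swap (i + d) (i + d + 1) c) = c
      rw [Equiv.swap_apply_of_ne_of_ne (by omega) (by omega), ih (by omega)]
  induction d with
  | zero => simp [braidProd, gapMap_apply, show c < i by omega]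
  | succ d ih =>
    rw [braidProd, map_mul, braidToSym_artin, Subgroup.coe_mul, Equiv.Perm.mul_apply]
    change (braidToSym (braidProd i d) : Equiv.Perm ℕ) (Equiv.swap (i + d) (i + d + 1) c) = _
    by_cases hcd : c = i + d
    · subst hcd
      rw [Equiv.swap_apply_left, hfix d _ (by omega), gapMap_apply, if_neg (by omega)]
    · rw [Equiv.swap_apply_of_ne_of_ne hcd (by omega), ih (by omega)]

/-- On labels below i + d both operators insert a gap at i, and the corresponding labeled vectors
are total in this level. -/
theorem Normal.rep_braidProd (h : S.Normal) (i d : ℕ) {x : S.Hinf} (hx : x ∈ S.level (i + d)) :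
    (h.rep.comp braidToSym) (braidProd i d) x = S.α i x := by
  have hle : S.level (i + d) ≤ LinearMap.eqLocus
      ((h.rep.comp braidToSym) (braidProd i d)).toLinearEquiv.toLinearMap (S.α i).toLinearMap := by
    refine level_le_of_labeled_le (isClosed_eq
      ((h.rep.comp braidToSym) (braidProd i d)).continuous (S.α i).continuous) ?_
    rintro χ hχ _ ⟨x, hx, rfl⟩
    change h.rep (braidToSym (braidProd i d)) (S.labelShift χ x) = S.α i (S.labelShift χ x)
    rw [h.rep_labelShift _ _ hx, α_labelShift _ _ (rootSpace_le_level _ hx)]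
    congr 2
    rw [gap, Finset.map_eq_image, Finset.map_eq_image]
    exact Finset.image_congr fun c hc =>
      braidToSym_braidProd_apply i d c (Finset.mem_range.1 (hχ hc))
  exact hle hx

theorem Normal.rep_artin (h : S.Normal) {n m : ℕ} (hm : n ≤ m) {x : S.Hinf}
    (hx : x ∈ S.level n) : (h.rep.comp braidToSym) (artin m) x = x := by
  have hle : S.level n ≤ LinearMap.eqLocus
      ((h.rep.comp braidToSym) (artin m)).toLinearEquiv.toLinearMap LinearMap.id := by
    refine level_le_of_labeled_le (isClosed_eq
      ((h.rep.comp braidToSym) (artin m)).continuous continuous_id) ?_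
    rintro χ hχ _ ⟨x, hx, rfl⟩
    change h.rep (braidToSym (artin m)) (S.labelShift χ x) = S.labelShift χ x
    rw [h.rep_labelShift _ _ hx, braidToSym_artin]
    congr 2
    rw [Finset.map_eq_image]
    refine (Finset.image_congr (g := id) fun c hc => ?_).trans Finset.image_id
    have := Finset.mem_range.1 (hχ hc)
    exact Equiv.swap_apply_of_ne_of_ne (by omega) (by omega)
  exact hle hx

/-- A vector fixed by all generators from n on is fixed by every product σ_{n+1} ⋯ σ_{n+d}. These
agree with α_n on ever larger levels, so α_n fixes the vector, and saturation puts it in level n. -/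
theorem Normal.braidFixed_rep (h : S.Normal) (n : ℕ) :
    braidFixed (h.rep.comp braidToSym) n = S.level n := by
  apply le_antisymm
  · intro x hx
    rw [mem_braidFixed] at hx
    have hfix : ∀ d, (h.rep.comp braidToSym) (braidProd n d) x = x := by
      intro d
      induction d with
      | zero => simp [braidProd]
      | succ d ih => rw [braidProd, rep_mul_apply, hx _ (by omega), ih]
    rw [level, h.saturated n, mem_fixed, ← sub_eq_zero, ← norm_le_zero_iff]
    refine le_of_forall_pos_le_add fun ε hε => ?_
    -- The error of the approximation enters twice, once under each of two isometries, whence ε / 2.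
    obtain ⟨y, hy, hxy⟩ := Metric.mem_closure_iff.1 (S.dense_iUnion_range_ι x) (ε / 2) (by positivity)
    obtain ⟨k, z, rfl⟩ := Set.mem_iUnion.1 hy
    have h1 := h.rep_braidProd n k (level_mono (by omega : k ≤ n + k) (ι_mem_level k z))
    rw [dist_eq_norm] at hxy
    calc ‖S.α n x - x‖ = ‖S.α n (x - S.ι k z) -
          (h.rep.comp braidToSym) (braidProd n k) (x - S.ι k z)‖ := by
          rw [map_sub, map_sub, hfix, h1, sub_sub_sub_cancel_right]
      _ ≤ ‖x - S.ι k z‖ + ‖x - S.ι k z‖ := (norm_sub_le _ _).trans_eq (by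
          rw [LinearIsometry.norm_map, LinearIsometryEquiv.norm_map])
      _ ≤ 0 + ε := by linarith
  · intro x hx
    exact (mem_braidFixed _).2 fun m hm => h.rep_artin hm hx

theorem Normal.isCanonicalSym (h : S.Normal) : S.IsCanonicalSym := by
  refine ⟨S.Hinf, inferInstance, inferInstance, inferInstance, h.rep,
    fun n => (S.levelEquiv n).trans (LinearIsometryEquiv.ofEq _ _ (h.braidFixed_rep n).symm),
    fun n i hi x => Subtype.ext ?_⟩
  change (h.rep.comp braidToSym) (braidProd i (n - i)) (S.ι n x) = S.ι (n + 1) (S.δ n i hi x)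
  rw [h.rep_braidProd i (n - i) (level_mono (by omega : n ≤ i + (n - i)) (ι_mem_level n x)),
    S.α_ι n i hi]

end SCH

end

/-! ### The equivalence of the seven conditions -/

theorem mainTheorem2 (S : SCH.{u}) :
    [S.Symmetric ∧ S.Saturated,
      S.IsCanonicalSym,
      S.Braided ∧ S.Saturated,
      S.IsCanonicalBraid,
      S.Normal,
      S.PreservesComplements,
      S.LabeledOrthogonal].TFAE := by
  tfae_have 1 → 2 := fun h => h.2.unitarilyEquivalent.isCanonicalSym_iff.2 h.1
  tfae_have 3 → 4 := fun h => h.2.unitarilyEquivalent.isCanonicalBraid_iff.2 h.1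
  tfae_have 2 → 4 := SCH.IsCanonicalSym.isCanonicalBraid
  tfae_have 4 → 5 := SCH.IsCanonicalBraid.normal
  -- Normality makes the SCH equivalent to its own saturation, so being canonical transfers to the
  -- saturation.
  tfae_have 5 → 1 := fun h =>
    ⟨h.saturated.unitarilyEquivalent.isCanonicalSym_iff.1 h.isCanonicalSym, h.saturated⟩
  tfae_have 1 → 3 := fun h => ⟨h.1.isCanonicalBraid, h.2⟩
  tfae_have 5 ↔ 6 := SCH.normal_iff_preservesComplements
  tfae_have 5 → 7 := SCH.Normal.labeledOrthogonal
  tfae_have 7 → 6 := SCH.LabeledOrthogonal.preservesComplements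
  tfae_finish
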